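/- All graphs are finite and simple. A $2$-fold cover of a graph $G$ is a pair $(L,H)$ of a graph $H$ and a map $L$ assigning to every $v\in V(G)$ a two-element set $L(v)\subseteq V(H)$ such that: the sets $L(v)$ partition $V(H)$; the two elements of each $L(v)$ are adjacent in $H$; for distinct $u,v$, the edges of $H$ between $L(u)$ and $L(v)$ form a (possibly empty) matching if $uv\in E(G)$, and there are none if $uv\notin E(G)$. In each $L(v)=\{p(v),r(v)\}$ one node $p(v)$ is designated poor and the other, $r(v)$, rich; this designation is arbitrary and is regarded as part of the cover. The graph $G$ is $(i,j)$-defective-DP-colorable if for every $2$-fold cover $(L,H)$ of $G$ (with every designation of poor and rich nodes) there is an injection $\varphi:V(G)\to V(H)$ with $\varphi(v)\in L(v)$ for all $v$ such that, in the subgraph of $H$ induced by $\varphi(V(G))$, every poor node has degree at most $i$ and every rich node has degree at most $j$. Let $i\in\{1,2\}$ and let $j\ge 2i$ be an integer. (1) If a graph $G$ satisfies $$|E(H)|\le \frac{(2i+1)|V(H)|+j-i}{i+1}\quad\text{for every subgraph } H \text{ of } G,$$ then $G$ is $(i,j)$-defective-DP-colorable. (2) This is sharp, for infinitely many orders: for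 infinitely many $n$ there is an $n$-vertex graph $G$ that is not $(i,j)$-defective-DP-colorable although $|E(H)|\le \frac{(2i+1)|V(H)|+j-i}{i+1}$ for every proper subgraph $H$ of $G$, and $|E(G)|=\frac{(2i+1)n+j-i+1}{i+1}$. In particular $j-i$ in (1) cannot be replaced by $j-i+1$. -/

import Mathlib

universe u

/-- A cover `(L, H)` of a simple graph `G`, where `H` is a graph on the type `W` of nodes. -/
structure DPCover {V : Type u} (G : SimpleGraph V) (W : Type u) where
  /-- The cover graph `H`. -/
  graph : SimpleGraph W
  /-- The set `L v` of nodes over the vertex `v`. -/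
  L : V → Set W
  /-- The sets `L v` partition the set of nodes. -/
  partition : ∀ x : W, ∃! v : V, x ∈ L v
  /-- Each `L v` induces a complete graph. -/
  complete : ∀ v : V, ∀ x ∈ L v, ∀ y ∈ L v, x ≠ y → graph.Adj x y
  /-- Edges of the cover graph lie inside some `L v` or over an edge of `G`. -/
  edge : ∀ v w : V, ∀ x ∈ L v, ∀ y ∈ L w, graph.Adj x y → v = w ∨ G.Adj v w
  /-- Over each edge `vw` of `G` the edges between `L v` and `L w` form a matching, possibly
  empty. (Swapping `v` and `w` gives the condition at the nodes of `L w`.) -/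
  matching : ∀ v w : V, G.Adj v w → ∀ x ∈ L v, ∀ y ∈ L w, ∀ z ∈ L w,
    graph.Adj x y → graph.Adj x z → y = z

namespace DPCover

variable {V : Type u} {G : SimpleGraph V} {W : Type u}

/-- The cover is `k`-fold. -/
def IsFold (C : DPCover G W) (k : ℕ) : Prop :=
  ∀ v : V, (C.L v).encard = k

/-- `φ` is an injection choosing a node of `L v` for every vertex `v`. -/
def IsMap (C : DPCover G W) (φ : V → W) : Prop :=
  Function.Injective φ ∧ ∀ v : V, φ v ∈ C.L v

/-- The subgraph of the cover graph induced by the image of `φ`. -/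
def inducedCoverGraph (C : DPCover G W) (φ : V → W) : SimpleGraph (Set.range φ) :=
  C.graph.induce (Set.range φ)

/-- `φ` is an `(i, j)`-defective colouring of the cover `C`, where `p v` and `r v` are the poor and
the rich node over `v`: poor nodes have degree at most `i`, and rich nodes degree at most `j`,
in the cover graph induced by `φ`. -/
def IsDefectiveColoring (C : DPCover G W) (p r : V → W) (i j : ℕ) (φ : V → W) : Prop :=
  C.IsMap φ ∧
    (∀ (v : V) (h : p v ∈ Set.range φ),
      ((C.inducedCoverGraph φ).neighborSet ⟨p v, h⟩).encard ≤ i) ∧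
    (∀ (v : V) (h : r v ∈ Set.range φ),
      ((C.inducedCoverGraph φ).neighborSet ⟨r v, h⟩).encard ≤ j)

end DPCover

/-- `G` is `(i, j)`-defective-DP-colorable: every `2`-fold cover of `G`, with any naming
`L v = {p v, r v}` of its poor and rich nodes, has an `(i, j)`-defective colouring. A `2`-fold cover
has as many nodes as `V × Bool`, so node types in the universe of `V` give all covers. -/
def IsDefectiveDPColorable {V : Type u} (G : SimpleGraph V) (i j : ℕ) : Prop :=
  ∀ (W : Type u) (C : DPCover G W), C.IsFold 2 →
    ∀ p r : V → W, (∀ v : V, C.L v = {p v, r v}) →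
      ∃ φ : V → W, C.IsDefectiveColoring p r i j φ

/-!
Sparse graphs are coloured through weighted instances (`Inst`). An instance gives capacities to the
two nodes of every vertex and has edges and half edges, each with a sign that tells which pairs of
nodes it joins; an active edge loads both of its nodes and an active half edge only one of them.
With `d = j - i`, the potential of a vertex set is the sum of the vertex weights (capacities plus
`1 - d`) minus `i + 1` for every edge and `1` for every half edge inside the set. For the instance
of a cover of `G`, with capacities `i` and `j` and without half edges, this is
`(2 * i + 1) * |S| - (i + 1) * |E(G[S])|`, so sparseness of `G` says that no potential is below `-d`.
`Inst.colorable_of_adm` shows by induction on the number of vertices that such an instance can be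
coloured.

When a set `W` has been coloured, an edge from `W` to an outer vertex `x` can be dealt with in two
ways. Either its node in `W` has spare capacity, and then it may as well only count at `x`; or the
node of `x` that it hits is given up. Giving up a poor node takes `i + 1` from its capacity, and
giving up a rich node is recorded, at the same cost, in the component `n` of the instance. What is left (`Inst.resid`) is again an instance,
and its potentials are differences of the old ones, increased by the spare capacity used. Hence in a
smallest uncolourable instance

* every nonempty proper subset has larger potential than the whole (`Inst.pot_lt_of_not_colorable`), no rich
  node is given up in advance (`Inst.n_eq_zero_of_not_colorable`), and every nonempty proper subset has
  potential at least `2 - d` (`Inst.two_le_pot_add`); the last two use `Inst.colorable_of_spare`,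
  where a single vertex with spare capacity repairs all sets of low potential;
* this room allows all vertices but one to be coloured with spare capacity at prescribed nodes, so
  that the last vertex can be added unless the edges at it weigh at least twice as much as the vertex
  (`Inst.two_mul_w_le`);
* so the excesses of the edges over the vertices are nonnegative, and as the whole has potential at
  least `-d` they sum to at most `2 * d`. A choice of nodes that locally minimises the conflicts,
  offset by the capacities, then nearly satisfies all capacities, with half edges counted one half
  at both ends, and half edges can be oriented accordingly (`exists_orientation`). This colours the
  instance (`Inst.colorable_of_two_mul_w_le`).

For the sharpness, `i + j + 2` gadgets share a centre: `j + 1` of them force a conflict upon its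
rich node and `i + 1` upon its poor node (`Gadget.not_isDefectiveDPColorable`). A gadget is a path of
arbitrary length with leaves; counted by `2 * i + 1` for a vertex and `-(i + 1)` for an edge, each
proper part of it weighs at least `0` and the whole, with its edges to the centre, weighs `-1`
(`Gadget.weight_nonneg_or`).
-/

set_option linter.unusedSectionVars false

namespace DefectiveDP

/-! ### Sums over pairs -/

section PairSum

variable {V : Type*} [DecidableEq V]

/-- The sum of a symmetric weight `q` over the unordered pairs inside `S`. The double sum is even if
`q` is symmetric and vanishes on the diagonal, and only then is the division meant. -/
def pairSum (q : V → V → ℤ) (S : Finset V) : ℤ := (∑ x ∈ S, ∑ y ∈ S, q x y) / 2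

variable {q : V → V → ℤ}

lemma pairSum_insert (hs : ∀ x y, q x y = q y x) (h0 : ∀ x, q x x = 0) {S : Finset V} {x : V}
    (hx : x ∉ S) : pairSum q (insert x S) = pairSum q S + ∑ y ∈ S, q x y := by
  have h : ∑ a ∈ insert x S, ∑ b ∈ insert x S, q a b
      = ∑ a ∈ S, ∑ b ∈ S, q a b + 2 * ∑ y ∈ S, q x y := by
    rw [Finset.sum_insert hx, Finset.sum_insert hx, h0]
    have : ∀ a ∈ S, ∑ b ∈ insert x S, q a b = q x a + ∑ b ∈ S, q a b := fun a _ => by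
      rw [Finset.sum_insert hx, hs a x]
    rw [Finset.sum_congr rfl this, Finset.sum_add_distrib]
    ring
  rw [pairSum, pairSum, h, Int.add_mul_ediv_left _ _ two_ne_zero]

lemma two_mul_pairSum (hs : ∀ x y, q x y = q y x) (h0 : ∀ x, q x x = 0) (S : Finset V) :
    2 * pairSum q S = ∑ x ∈ S, ∑ y ∈ S, q x y := by
  induction S using Finset.induction_on with
  | empty => simp [pairSum]
  | insert x S hx ih =>
    rw [pairSum_insert hs h0 hx, Finset.sum_insert hx, Finset.sum_insert hx, h0]
    have : ∀ a ∈ S, ∑ b ∈ insert x S, q a b = q x a + ∑ b ∈ S, q a b := fun a _ => by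
      rw [Finset.sum_insert hx, hs a x]
    rw [Finset.sum_congr rfl this, Finset.sum_add_distrib]
    linarith

lemma pairSum_union (hs : ∀ x y, q x y = q y x) (h0 : ∀ x, q x x = 0) {S T : Finset V}
    (hd : Disjoint S T) :
    pairSum q (S ∪ T) = pairSum q S + pairSum q T + ∑ x ∈ S, ∑ y ∈ T, q x y := by
  have h1 := two_mul_pairSum hs h0 (S ∪ T)
  have h2 := two_mul_pairSum hs h0 S
  have h3 := two_mul_pairSum hs h0 T
  rw [Finset.sum_union hd] at h1
  simp only [Finset.sum_union hd, Finset.sum_add_distrib] at h1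
  have h4 : ∑ x ∈ T, ∑ y ∈ S, q x y = ∑ x ∈ S, ∑ y ∈ T, q x y := by
    rw [Finset.sum_comm]
    exact Finset.sum_congr rfl fun x _ => Finset.sum_congr rfl fun y _ => hs _ _
  linarith

/-- Supermodularity of `pairSum`, with the pairs that are split by `S` and `T` as error term. -/
lemma pairSum_add_le (hs : ∀ x y, q x y = q y x) (h0 : ∀ x, q x x = 0) (S T : Finset V) :
    pairSum q S + pairSum q T + ∑ x ∈ S \ T, ∑ y ∈ T \ S, q x y
      ≤ pairSum q (S ∪ T) + pairSum q (S ∩ T) := by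
  have h1 : pairSum q (S ∪ T) = pairSum q S + pairSum q (T \ S) + ∑ x ∈ S, ∑ y ∈ T \ S, q x y := by
    rw [← pairSum_union hs h0 Finset.disjoint_sdiff, Finset.union_sdiff_self_eq_union]
  have h2 : pairSum q T = pairSum q (S ∩ T) + pairSum q (T \ S)
      + ∑ x ∈ S ∩ T, ∑ y ∈ T \ S, q x y := by
    have hd : Disjoint (S ∩ T) (T \ S) :=
      Finset.disjoint_of_subset_left Finset.inter_subset_left Finset.disjoint_sdiff
    rw [← pairSum_union hs h0 hd]
    congr 1
    ext a
    simp only [Finset.mem_union, Finset.mem_inter, Finset.mem_sdiff]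
    tauto
  have h3 : ∑ x ∈ S, ∑ y ∈ T \ S, q x y
      = ∑ x ∈ S ∩ T, ∑ y ∈ T \ S, q x y + ∑ x ∈ S \ T, ∑ y ∈ T \ S, q x y :=
    (Finset.sum_inter_add_sum_sdiff S T _).symm
  linarith

/-- Adding one to the weight of the pair `s`, `t`. -/
lemma pairSum_add_pair (hs : ∀ x y, q x y = q y x) (h0 : ∀ x, q x x = 0) {s t : V} (hst : s ≠ t)
    (S : Finset V) :
    pairSum (fun x y => q x y + ((if x = s then if y = t then 1 else 0 else 0)
      + (if x = t then if y = s then 1 else 0 else 0))) S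
      = pairSum q S + if s ∈ S ∧ t ∈ S then 1 else 0 := by
  have h1 := two_mul_pairSum (q := fun x y => q x y + ((if x = s then if y = t then 1 else 0 else 0)
      + (if x = t then if y = s then 1 else 0 else 0))) (fun x y => by
        rw [hs x y, add_comm (ite _ _ _)]
        simp only [← ite_and, and_comm]) (fun x => by
        by_cases hx : x = s
        · subst hx; simp [h0, hst]
        · simp [h0, hx]) S
  have h2 := two_mul_pairSum hs h0 S
  have h4 : ∀ s t : V, ∑ x ∈ S, ∑ y ∈ S, (if x = s then if y = t then (1 : ℤ) else 0 else 0)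
      = if s ∈ S ∧ t ∈ S then 1 else 0 := by
    intro s t
    have : ∀ x ∈ S, ∑ y ∈ S, (if x = s then if y = t then (1 : ℤ) else 0 else 0)
        = if x = s then (if t ∈ S then 1 else 0) else 0 := by
      intro x _
      split_ifs <;> simp [*]
    rw [Finset.sum_congr rfl this, Finset.sum_ite_eq', ite_and]
  simp only [Finset.sum_add_distrib, h4] at h1
  have h5 : (if t ∈ S ∧ s ∈ S then (1 : ℤ) else 0) = if s ∈ S ∧ t ∈ S then 1 else 0 := by
    simp only [and_comm]
  rw [h5] at h1
  linarith

end PairSum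

/-! ### Weighted instances -/

/-- A weighted cover instance on `V`. Every vertex `x` has a poor node `(x, false)` and a rich node
`(x, true)` of capacities `c x false` and `c x true`; a node of negative capacity is unusable.
There are two kinds of edges, and the sign `b` of an edge tells which nodes it joins: `(x, α)` and
`(y, β)` with `α ^^ β = b`. An edge counted by `r` whose two nodes are both chosen loads both of
them; an edge counted by `h`, a half edge, loads only one of them. The rich node of `x` is
forbidden when `n x ≠ 0`. -/
structure Inst (V : Type*) where
  /-- capacities -/
  c : V → Bool → ℤ
  /-- the number of times the rich node has been forbidden -/
  n : V → ℕ
  /-- the number of edges of each sign -/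
  r : V → V → Bool → ℕ
  /-- the number of half edges of each sign -/
  h : V → V → Bool → ℕ
  r_symm : ∀ x y b, r x y b = r y x b
  h_symm : ∀ x y b, h x y b = h y x b
  r_self : ∀ x b, r x x b = 0
  h_self : ∀ x b, h x x b = 0
  r_le : ∀ x y, r x y false + r x y true ≤ 1

namespace Inst

variable {V : Type*} [DecidableEq V] (I : Inst V) (i d : ℤ)

/-- The number of edges between `x` and `y`. -/
def R (x y : V) : ℕ := I.r x y false + I.r x y true

/-- The number of half edges between `x` and `y`. -/
def H (x y : V) : ℕ := I.h x y false + I.h x y true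

/-- The weight of the edges and half edges between `x` and `y`. -/
def q (x y : V) : ℤ := (i + 1) * I.R x y + I.H x y

/-- The potential of a vertex. -/
def w (x : V) : ℤ := I.c x false + I.c x true + 1 - d - (i + 1) * I.n x

/-- The potential of a set of vertices. -/
def pot (S : Finset V) : ℤ := ∑ x ∈ S, I.w i d x - pairSum (I.q i) S

/-- The choice `φ` of nodes on `A` respects the capacities, where `o x y` of the half edges between
`x` and `y` load the node of `x`. -/
def IsColoring (A : Finset V) (φ : V → Bool) (o : V → V → ℕ) : Prop :=
  (∀ x ∈ A, φ x = true → I.n x = 0) ∧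
  (∀ x ∈ A, ∀ y ∈ A, I.h x y (φ x ^^ φ y) ≤ o x y + o y x) ∧
  ∀ x ∈ A, ∑ y ∈ A, ((I.r x y (φ x ^^ φ y) : ℤ) + o x y) ≤ I.c x (φ x)

/-- The instance restricted to `A` has a colouring. -/
def Colorable (A : Finset V) : Prop := ∃ φ o, I.IsColoring A φ o

/-- The sparseness condition: all potentials are at least `-d`, and those of the sets that contain a
vertex with forbidden rich node are at least `0`. -/
def Adm (A : Finset V) : Prop :=
  (∀ x ∈ A, I.c x false ≤ i ∧ I.c x true ≤ i + d) ∧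
  ∀ S ⊆ A, S.Nonempty → -d ≤ I.pot i d S ∧ ((∃ x ∈ S, I.n x ≠ 0) → 0 ≤ I.pot i d S)

variable {I i d}

lemma q_symm (x y : V) : I.q i x y = I.q i y x := by
  simp only [q, R, H, I.r_symm x y, I.h_symm x y]

lemma q_self (x : V) : I.q i x x = 0 := by
  simp [q, R, H, I.r_self, I.h_self]

lemma q_nonneg (hi : 0 ≤ i) (x y : V) : 0 ≤ I.q i x y := by
  unfold q; positivity

@[simp] lemma pot_empty : I.pot i d ∅ = 0 := by simp [pot, pairSum]

@[simp] lemma pot_singleton (x : V) : I.pot i d {x} = I.w i d x := by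
  simp [pot, pairSum, q_self]

lemma pot_union {S T : Finset V} (h : Disjoint S T) :
    I.pot i d (S ∪ T) = I.pot i d S + I.pot i d T - ∑ x ∈ S, ∑ y ∈ T, I.q i x y := by
  rw [pot, pot, pot, pairSum_union q_symm q_self h, Finset.sum_union h]
  ring

lemma pot_insert {S : Finset V} {x : V} (h : x ∉ S) :
    I.pot i d (insert x S) = I.pot i d S + I.w i d x - ∑ y ∈ S, I.q i x y := by
  rw [pot, pot, pairSum_insert q_symm q_self h, Finset.sum_insert h]
  ring

lemma pot_submod (hi : 0 ≤ i) (S T : Finset V) :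
    I.pot i d (S ∪ T) + I.pot i d (S ∩ T) ≤ I.pot i d S + I.pot i d T := by
  have h1 := pairSum_add_le (q := I.q i) q_symm q_self S T
  have h2 : ∑ x ∈ S ∪ T, I.w i d x + ∑ x ∈ S ∩ T, I.w i d x
      = ∑ x ∈ S, I.w i d x + ∑ x ∈ T, I.w i d x := Finset.sum_union_inter
  have h3 : 0 ≤ ∑ x ∈ S \ T, ∑ y ∈ T \ S, I.q i x y :=
    Finset.sum_nonneg fun x _ => Finset.sum_nonneg fun y _ => q_nonneg hi x y
  unfold pot
  linarith

lemma Adm.mono {A B : Finset V} (h : I.Adm i d A) (hB : B ⊆ A) : I.Adm i d B :=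
  ⟨fun x hx => h.1 x (hB hx), fun S hS => h.2 S (hS.trans hB)⟩

/-! ### Residual instances -/

variable (I) in
/-- The instance left on the complement of `W` when `W` has been coloured by `φ`. Of the edges and
half edges leaving `s ∈ W`, those counted by `fr` and `fh` also load the node of `s`; so such an
edge only loads the node at its other end, and such a half edge does not load it. Every other edge
forbids the node at its other end: a poor node loses `i + 1` of its capacity, which makes it
negative, and a rich node is forbidden by `n`. The functions `fr` and `fh` are meant to be bounded by
the numbers of edges and half edges. -/
def resid (i : ℤ) (W : Finset V) (φ : V → Bool) (fr fh : V → V → Bool → ℕ) : Inst V where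
  c x β := I.c x β - ∑ s ∈ W, ((fr s x (φ s ^^ β) : ℤ) + (I.h s x (φ s ^^ β) - fh s x (φ s ^^ β))
    + bif β then 0 else (i + 1) * (I.r s x (φ s ^^ β) - fr s x (φ s ^^ β)))
  n x := I.n x + ∑ s ∈ W, (I.r s x (φ s ^^ true) - fr s x (φ s ^^ true))
  r := I.r
  h := I.h
  r_symm := I.r_symm
  h_symm := I.h_symm
  r_self := I.r_self
  h_self := I.h_self
  r_le := I.r_le

section Resid

variable {W : Finset V} {φ : V → Bool} {fr fh : V → V → Bool → ℕ}

/-- The edges from `W` lower the weight of an outer vertex by their own weights, except for what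
their nodes in `W` take over. -/
lemma resid_w (hfr : ∀ s x b, fr s x b ≤ I.r s x b) (x : V) :
    (I.resid i W φ fr fh).w i d x = I.w i d x - ∑ s ∈ W, I.q i s x
      + ∑ s ∈ W, (i * ((fr s x false : ℤ) + fr s x true) + ((fh s x false : ℤ) + fh s x true)) := by
  have hn : ((I.resid i W φ fr fh).n x : ℤ)
      = I.n x + ∑ s ∈ W, ((I.r s x (φ s ^^ true) : ℤ) - fr s x (φ s ^^ true)) := by
    simp only [resid]
    push_cast
    congr 1
    exact Finset.sum_congr rfl fun s _ => by rw [Nat.cast_sub (hfr _ _ _)]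
  rw [w, hn]
  simp only [resid, w, cond_true, cond_false, mul_add, Finset.mul_sum]
  have : ∀ a b c e f g S T : ℤ, S + T + g = e - f →
      a - S + (b - T) + 1 - d - (c + g) = a + b + 1 - d - c - e + f := by intros; linarith
  apply this
  rw [← Finset.sum_add_distrib, ← Finset.sum_add_distrib, ← Finset.sum_sub_distrib]
  refine Finset.sum_congr rfl fun s _ => ?_
  simp only [q, R, H]
  push_cast
  cases φ s <;> simp <;> ring

lemma resid_pot (hfr : ∀ s x b, fr s x b ≤ I.r s x b) {X : Finset V} (hX : Disjoint W X) :
    (I.resid i W φ fr fh).pot i d X = I.pot i d (W ∪ X) - I.pot i d W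
      + ∑ x ∈ X, ∑ s ∈ W, (i * ((fr s x false : ℤ) + fr s x true)
        + ((fh s x false : ℤ) + fh s x true)) := by
  have h1 : pairSum ((I.resid i W φ fr fh).q i) X = pairSum (I.q i) X := rfl
  have h2 : ∑ x ∈ X, ∑ s ∈ W, I.q i s x = ∑ x ∈ W, ∑ y ∈ X, I.q i x y := Finset.sum_comm
  rw [pot_union hX, pot, h1, Finset.sum_congr rfl fun x _ => resid_w hfr x,
    Finset.sum_add_distrib, Finset.sum_sub_distrib, h2, pot, pot]
  ring

lemma resid_c_le (hi : 0 ≤ i) (hfr : ∀ s x b, fr s x b ≤ I.r s x b)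
    (x : V) (β : Bool) :
    (I.resid i W φ fr fh).c x β ≤ I.c x β - ∑ s ∈ W, ((fr s x (φ s ^^ β) : ℤ)
      + (I.h s x (φ s ^^ β) - fh s x (φ s ^^ β))) := by
  simp only [resid, Finset.sum_add_distrib]
  have : 0 ≤ ∑ s ∈ W, bif β then 0 else (i + 1) * ((I.r s x (φ s ^^ β) : ℤ)
      - fr s x (φ s ^^ β)) := by
    refine Finset.sum_nonneg fun s _ => ?_
    have := hfr s x (φ s ^^ β)
    cases β
    · exact mul_nonneg (by linarith) (by simpa using this)
    · simp
  linarith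

/-- A colouring of `W` and a colouring of the residual instance fit together: an edge that forbids
the node at its outer end is not active, and the other ones are paid for on both sides. -/
lemma colorable_of_resid (hi : 0 ≤ i) {A : Finset V} (hW : W ⊆ A)
    (hc : ∀ x ∈ A, I.c x false ≤ i) {o : V → V → ℕ}
    (hfr : ∀ s x b, fr s x b ≤ I.r s x b) (hfh : ∀ s x b, fh s x b ≤ I.h s x b)
    (h1 : ∀ x ∈ W, φ x = true → I.n x = 0)
    (h2 : ∀ x ∈ W, ∀ y ∈ W, I.h x y (φ x ^^ φ y) ≤ o x y + o y x)
    (h3 : ∀ x ∈ W, ∑ y ∈ W, ((I.r x y (φ x ^^ φ y) : ℤ) + o x y)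
      + ∑ y ∈ A \ W, (((fr x y false : ℤ) + fr x y true) + ((fh x y false : ℤ) + fh x y true))
      ≤ I.c x (φ x))
    (hB : (I.resid i W φ fr fh).Colorable (A \ W)) : I.Colorable A := by
  obtain ⟨ψ, p, g1, g2, g3⟩ := hB
  have hcl := @resid_c_le V _ I i W φ fr fh hi hfr
  have hA : W ∪ (A \ W) = A := Finset.union_sdiff_of_subset hW
  have hdis : Disjoint W (A \ W) := Finset.disjoint_sdiff
  -- the edges that load only their outer node are not active
  have key : ∀ s ∈ W, ∀ x ∈ A \ W, I.r s x (φ s ^^ ψ x) = fr s x (φ s ^^ ψ x) := by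
    intro s hs x hx
    refine le_antisymm ?_ (hfr _ _ _)
    by_contra hlt
    push Not at hlt
    rcases hψ : ψ x with _ | _
    · have hb := g3 x hx
      rw [hψ] at hb hlt
      have hge : (0 : ℤ) ≤ ∑ y ∈ A \ W, (((I.resid i W φ fr fh).r x y (false ^^ ψ y) : ℤ) + p x y) :=
        Finset.sum_nonneg fun y _ => by positivity
      have hle : (I.resid i W φ fr fh).c x false ≤ I.c x false - (i + 1) := by
        simp only [resid]
        have := Finset.single_le_sum (s := W) (a := s)
          (f := fun s => (fr s x (φ s ^^ false) : ℤ)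
            + (I.h s x (φ s ^^ false) - fh s x (φ s ^^ false))
            + bif false then 0 else (i + 1) * ((I.r s x (φ s ^^ false) : ℤ)
              - fr s x (φ s ^^ false))) (fun t _ => ?_) hs
        · refine sub_le_sub_left (le_trans ?_ this) _
          have a1 := hfh s x (φ s ^^ false)
          have a2 : (1 : ℤ) ≤ (I.r s x (φ s ^^ false) : ℤ) - fr s x (φ s ^^ false) := by omega
          simp only [cond_false]
          nlinarith
        · have a1 := hfh t x (φ t ^^ false)
          have a2 : (0 : ℤ) ≤ (I.r t x (φ t ^^ false) : ℤ) - fr t x (φ t ^^ false) := by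
            have := hfr t x (φ t ^^ false)
            omega
          simp only [cond_false]
          have : (0 : ℤ) ≤ (i + 1) * ((I.r t x (φ t ^^ false) : ℤ) - fr t x (φ t ^^ false)) :=
            mul_nonneg (by linarith) a2
          omega
      have := hc x (Finset.mem_sdiff.1 hx).1
      linarith
    · have hb := g1 x hx hψ
      rw [hψ] at hlt
      simp only [resid, Nat.add_eq_zero_iff, Finset.sum_eq_zero_iff] at hb
      have := hb.2 s hs
      omega
  refine ⟨fun x => if x ∈ W then φ x else ψ x, fun x y => if x ∈ W then
    (if y ∈ W then o x y else fh x y (φ x ^^ ψ y)) else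
    (if y ∈ W then I.h x y (ψ x ^^ φ y) - fh y x (ψ x ^^ φ y) else p x y), ?_, ?_, ?_⟩
  · intro x hx
    by_cases hxW : x ∈ W
    · simpa [hxW] using h1 x hxW
    · intro hψ
      simp only [hxW, if_false] at hψ
      have := g1 x (by simp [hx, hxW]) hψ
      simp only [resid, Nat.add_eq_zero_iff] at this
      exact this.1
  · intro x hx y hy
    by_cases hxW : x ∈ W <;> by_cases hyW : y ∈ W
    · simpa [hxW, hyW] using h2 x hxW y hyW
    · simp only [hxW, hyW, if_true, if_false]
      rw [I.h_symm y x, Bool.xor_comm (ψ y)]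
      omega
    · simp only [hxW, hyW, if_true, if_false]
      rw [Bool.xor_comm (φ y)]
      omega
    · simpa [hxW, hyW, resid] using g2 x (by simp [hx, hxW]) y (by simp [hy, hyW])
  · intro x hx
    rw [← hA, Finset.sum_union hdis]
    have hnot : ∀ y ∈ A \ W, y ∉ W := fun y hy => (Finset.mem_sdiff.1 hy).2
    by_cases hxW : x ∈ W
    · simp only [hxW, if_true]
      refine le_trans (add_le_add ?_ ?_) (h3 x hxW)
      · exact le_of_eq (Finset.sum_congr rfl fun y hy => by simp [hy])
      · refine Finset.sum_le_sum fun y hy => ?_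
        simp only [hnot y hy, if_false]
        rw [key x hxW y hy]
        cases (φ x ^^ ψ y) <;> omega
    · have hxB : x ∈ A \ W := by simp [hx, hxW]
      simp only [hxW, if_false]
      have e1 : ∑ y ∈ W, ((I.r x y (ψ x ^^ if y ∈ W then φ y else ψ y) : ℤ)
          + ((if y ∈ W then I.h x y (ψ x ^^ φ y) - fh y x (ψ x ^^ φ y) else p x y : ℕ) : ℤ))
          = ∑ s ∈ W, ((fr s x (φ s ^^ ψ x) : ℤ)
            + (I.h s x (φ s ^^ ψ x) - fh s x (φ s ^^ ψ x))) := by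
        refine Finset.sum_congr rfl fun y hy => ?_
        simp only [hy, if_true]
        rw [I.r_symm x y, Bool.xor_comm (ψ x), key y hy x hxB, I.h_symm x y,
          Nat.cast_sub (hfh _ _ _)]
      have e2 : ∑ y ∈ A \ W, ((I.r x y (ψ x ^^ if y ∈ W then φ y else ψ y) : ℤ)
          + ((if y ∈ W then I.h x y (ψ x ^^ φ y) - fh y x (ψ x ^^ φ y) else p x y : ℕ) : ℤ))
          = ∑ y ∈ A \ W, (((I.resid i W φ fr fh).r x y (ψ x ^^ ψ y) : ℤ) + p x y) :=
        Finset.sum_congr rfl fun y hy => by simp [hnot y hy, resid]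
      rw [e1, e2]
      have := g3 x hxB
      have := hcl x (ψ x)
      linarith

end Resid

variable {A : Finset V}

/-! ### Spending spare capacity -/

/-- All admissible instances on fewer than `k` vertices are colourable. -/
def ColorableBelow (V : Type*) [DecidableEq V] (i d : ℤ) (k : ℕ) : Prop :=
  ∀ (J : Inst V) (B : Finset V), B.card < k → J.Adm i d B → J.Colorable B

/-- The load of the node of `x` in the set `W` coloured by `φ` and `o`. -/
def load (I : Inst V) (φ : V → Bool) (o : V → V → ℕ) (W : Finset V) (x : V) : ℤ :=
  ∑ y ∈ W, ((I.r x y (φ x ^^ φ y) : ℤ) + o x y)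

/-- After a colouring of `W` with spare capacities `fr` and `fh`, it suffices that no residual
potential is negative; then it does not matter which rich nodes have been forbidden. -/
lemma colorable_of_resid_pot (hi : 0 ≤ i) (hd : 0 ≤ d) (hadm : I.Adm i d A)
    (ih : ColorableBelow V i d A.card) {W : Finset V} (hW : W ⊆ A) (hWn : W.Nonempty)
    {φ : V → Bool} {o : V → V → ℕ} {fr fh : V → V → Bool → ℕ}
    (hfr : ∀ s x b, fr s x b ≤ I.r s x b) (hfh : ∀ s x b, fh s x b ≤ I.h s x b)
    (h1 : ∀ x ∈ W, φ x = true → I.n x = 0)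
    (h2 : ∀ x ∈ W, ∀ y ∈ W, I.h x y (φ x ^^ φ y) ≤ o x y + o y x)
    (h3 : ∀ x ∈ W, I.load φ o W x
      + ∑ y ∈ A \ W, (((fr x y false : ℤ) + fr x y true) + ((fh x y false : ℤ) + fh x y true))
      ≤ I.c x (φ x))
    (hp : ∀ X ⊆ A \ W, X.Nonempty → I.pot i d W ≤ I.pot i d (W ∪ X)
      + ∑ x ∈ X, ∑ s ∈ W, (i * ((fr s x false : ℤ) + fr s x true)
        + ((fh s x false : ℤ) + fh s x true))) : I.Colorable A := by
  refine colorable_of_resid hi hW (fun x hx => (hadm.1 x hx).1) hfr hfh h1 h2 h3 (ih _ _ ?_ ?_)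
  · rw [Finset.card_sdiff_of_subset hW]
    have := Finset.card_le_card hW
    have := hWn.card_pos
    omega
  · have hc : ∀ x β, (I.resid i W φ fr fh).c x β ≤ I.c x β := by
      intro x β
      refine (resid_c_le hi hfr x β).trans (sub_le_self _ (Finset.sum_nonneg fun s _ => ?_))
      have := hfh s x (φ s ^^ β)
      omega
    refine ⟨fun x hx => ?_, fun S hS hSn => ?_⟩
    · have := hadm.1 x (Finset.mem_sdiff.1 hx).1
      exact ⟨(hc x _).trans this.1, (hc x _).trans this.2⟩
    · have h := hp S hS hSn
      have : Disjoint W S := Finset.disjoint_of_subset_right hS Finset.disjoint_sdiff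
      rw [resid_pot hfr this]
      constructor
      · linarith
      · intro; linarith

/-- If some proper subset has the least potential, then it can be coloured first. -/
lemma colorable_of_pot_le (hi : 0 ≤ i) (hd : 0 ≤ d) (hadm : I.Adm i d A)
    (ih : ColorableBelow V i d A.card) {S : Finset V} (hS : S ⊂ A) (hSn : S.Nonempty)
    (hmin : ∀ X ⊆ A, X.Nonempty → I.pot i d S ≤ I.pot i d X) : I.Colorable A := by
  obtain ⟨φ, o, g1, g2, g3⟩ := ih I S (Finset.card_lt_card hS) (hadm.mono hS.1)
  refine colorable_of_resid_pot hi hd hadm ih hS.1 hSn (fr := fun _ _ _ => 0)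
    (fh := fun _ _ _ => 0) (by simp) (by simp) g1 g2 (by simpa [load] using g3) ?_
  intro X hX hXn
  simpa using hmin (S ∪ X) (Finset.union_subset hS.1 (hX.trans Finset.sdiff_subset))
    (hSn.mono Finset.subset_union_left)

lemma pot_lt_of_not_colorable (hi : 0 ≤ i) (hd : 0 ≤ d) (hadm : I.Adm i d A)
    (ih : ColorableBelow V i d A.card) (hnot : ¬ I.Colorable A) {S : Finset V} (hS : S ⊂ A)
    (hSn : S.Nonempty) : I.pot i d A < I.pot i d S := by
  obtain ⟨T, hT, hmin⟩ := Finset.exists_min_image (A.powerset.filter Finset.Nonempty)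
    (I.pot i d) ⟨A, by simp [hSn.mono hS.1]⟩
  simp only [Finset.mem_filter, Finset.mem_powerset] at hT hmin
  by_cases hTA : T = A
  · subst hTA
    by_contra hlt
    exact hnot (colorable_of_pot_le hi hd hadm ih hS hSn fun X hX hXn =>
      (not_lt.1 hlt).trans (hmin X ⟨hX, hXn⟩))
  · exact absurd (colorable_of_pot_le hi hd hadm ih (hT.1.ssubset_of_ne hTA) hT.2
      fun X hX hXn => hmin X ⟨hX, hXn⟩) hnot

/-- A function below `U` with sum at most `κ` can be raised until its sum is `κ` or it is `U`. -/
lemma exists_extend {B : Finset V} {U u₀ : V → ℕ} {κ : ℕ} (h0 : ∀ y ∈ B, u₀ y ≤ U y)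
    (hs : ∑ y ∈ B, u₀ y ≤ κ) : ∃ u : V → ℕ, (∀ y ∈ B, u₀ y ≤ u y ∧ u y ≤ U y) ∧
      ∑ y ∈ B, u y ≤ κ ∧ (∑ y ∈ B, u y = κ ∨ ∀ y ∈ B, u y = U y) := by
  obtain ⟨m, hm⟩ := Nat.exists_eq_add_of_le hs
  induction m generalizing u₀ with
  | zero => exact ⟨u₀, fun y hy => ⟨le_rfl, h0 y hy⟩, hs, Or.inl hm.symm⟩
  | succ m ih =>
    by_cases h : ∀ y ∈ B, u₀ y = U y
    · exact ⟨u₀, fun y hy => ⟨le_rfl, h0 y hy⟩, hs, Or.inr h⟩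
    · push Not at h
      obtain ⟨z, hz, hne⟩ := h
      have hlt := lt_of_le_of_ne (h0 z hz) hne
      have hsum : ∑ y ∈ B, (u₀ y + if y = z then 1 else 0) = ∑ y ∈ B, u₀ y + 1 := by
        rw [Finset.sum_add_distrib]
        simp [hz]
      obtain ⟨u, a1, a2⟩ := @ih (fun y => u₀ y + if y = z then 1 else 0)
        (fun y hy => by
          by_cases hyz : y = z
          · subst hyz; simpa using hlt
          · simpa [hyz] using h0 y hy) (by omega) (by omega)
      exact ⟨u, fun y hy => ⟨(Nat.le_add_right _ _).trans (a1 y hy).1, (a1 y hy).2⟩, a2⟩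

lemma exists_split (a b c e u : ℕ) (h : u ≤ a + b + (c + e)) : ∃ f : (ℕ × ℕ) × (ℕ × ℕ),
    f.1.1 ≤ a ∧ f.1.2 ≤ b ∧ f.2.1 ≤ c ∧ f.2.2 ≤ e ∧ f.1.1 + f.1.2 + (f.2.1 + f.2.2) = u :=
  ⟨((min u a, min (u - a) b), (min (u - a - b) c, min (u - a - b - c) e)), by
    dsimp only; omega⟩

/-- A coloured set `Z` in which the node of one vertex `x` has spare capacity `κ`. The spare
capacity is used up on edges from `x` to the outside, chosen so that all residual potentials become
nonnegative. -/
lemma colorable_of_spare (hi : 1 ≤ i) (hd : 0 ≤ d) (hadm : I.Adm i d A)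
    (ih : ColorableBelow V i d A.card) {Z : Finset V} (hZ : Z ⊂ A) {x : V} (hx : x ∈ Z)
    {φ : V → Bool} {o : V → V → ℕ} {κ : ℕ} {b₀ : ℤ}
    (g1 : ∀ x ∈ Z, φ x = true → I.n x = 0)
    (g2 : ∀ x ∈ Z, ∀ y ∈ Z, I.h x y (φ x ^^ φ y) ≤ o x y + o y x)
    (g3 : ∀ y ∈ Z, I.load φ o Z y ≤ I.c y (φ y))
    (g4 : I.load φ o Z x + κ ≤ I.c x (φ x))
    (h1 : ∀ Y, Z ⊂ Y → Y ⊂ A → b₀ + 1 ≤ I.pot i d Y)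
    (h2 : I.pot i d Z ≤ b₀ + 2)
    (h3 : I.pot i d Z = b₀ + 2 → ∀ Y, Z ⊂ Y → Y ⊂ A → I.pot i d Y = b₀ + 1 →
      0 < ∑ y ∈ Y \ Z, I.q i x y)
    (h4 : I.pot i d Z - I.pot i d A ≤ κ)
    (h5 : I.pot i d Z - I.pot i d A ≤ ∑ y ∈ A \ Z, (i * I.R x y + I.H x y))
    (h6 : I.pot i d Z = b₀ + 2 → 2 ≤ κ) : I.Colorable A := by
  classical
  set U : V → ℕ := fun y => I.R x y + I.H x y with hU
  have hq : ∀ Y : Finset V, 0 < ∑ y ∈ Y \ Z, I.q i x y → ∃ y ∈ Y \ Z, 0 < U y := by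
    intro Y hY
    by_contra hcon
    push Not at hcon
    refine hY.ne' (Finset.sum_eq_zero fun y hy => ?_)
    have := hcon y hy
    simp only [hU, Nat.le_zero, Nat.add_eq_zero_iff] at this
    simp [q, this.1, this.2]
  -- a set of at most two edges at `x` that meets all sets whose potential is too low
  obtain ⟨u₀, hu0, hu0s, hu0b⟩ : ∃ u₀ : V → ℕ, (∀ y ∈ A \ Z, u₀ y ≤ U y) ∧
      ∑ y ∈ A \ Z, u₀ y ≤ κ ∧ (I.pot i d Z = b₀ + 2 → ∀ Y, Z ⊂ Y → Y ⊂ A →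
        I.pot i d Y = b₀ + 1 → ∃ y ∈ Y \ Z, 0 < u₀ y) := by
    by_cases hex : I.pot i d Z = b₀ + 2 ∧ ∃ Y, Z ⊂ Y ∧ Y ⊂ A ∧ I.pot i d Y = b₀ + 1
    · obtain ⟨hpZ, Y₁, hY1, hY1A, hpY1⟩ := hex
      obtain ⟨z₁, hz1, hz1U⟩ := hq _ (h3 hpZ Y₁ hY1 hY1A hpY1)
      have hz1A : z₁ ∈ A \ Z := Finset.sdiff_subset_sdiff hY1A.1 le_rfl hz1
      by_cases hex2 : ∃ Y, (Z ⊂ Y ∧ Y ⊂ A ∧ I.pot i d Y = b₀ + 1) ∧ z₁ ∉ Y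
      · obtain ⟨Y₂, hY2, hmin⟩ := Finset.exists_min_image
          (A.powerset.filter fun Y => (Z ⊂ Y ∧ Y ⊂ A ∧ I.pot i d Y = b₀ + 1) ∧ z₁ ∉ Y)
          Finset.card (by
            obtain ⟨Y, hY⟩ := hex2
            exact ⟨Y, by simp only [Finset.mem_filter, Finset.mem_powerset]; exact ⟨hY.1.2.1.1, hY⟩⟩)
        simp only [Finset.mem_filter, Finset.mem_powerset] at hY2 hmin
        obtain ⟨-, ⟨hZ2, hA2, hp2⟩, hz2⟩ := hY2
        obtain ⟨z₂, hz2Y, hz2U⟩ := hq _ (h3 hpZ Y₂ hZ2 hA2 hp2)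
        have hz2A : z₂ ∈ A \ Z := Finset.sdiff_subset_sdiff hA2.1 le_rfl hz2Y
        have hne : z₁ ≠ z₂ := by
          rintro rfl
          exact hz2 (Finset.mem_sdiff.1 hz2Y).1
        refine ⟨fun y => if y = z₁ ∨ y = z₂ then 1 else 0, fun y _ => ?_, ?_, fun _ Y hZY hYA hpY => ?_⟩
        · dsimp only
          split_ifs with h
          · rcases h with rfl | rfl <;> assumption
          · exact Nat.zero_le _
        · refine le_trans ?_ (h6 hpZ)
          rw [Finset.sum_boole]
          refine le_trans (Nat.cast_le.2 (Finset.card_le_card (t := {z₁, z₂}) ?_)) ?_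
          · intro y hy
            simpa using (Finset.mem_filter.1 hy).2
          · exact Finset.card_le_two
        · by_cases hz : z₁ ∈ Y
          · exact ⟨z₁, by simp [hz, (Finset.mem_sdiff.1 hz1).2], by simp⟩
          · -- blocked sets that avoid `z₁` are closed under intersection
            have hsub := pot_submod (I := I) (i := i) (d := d) (by linarith) Y Y₂
            have hZi : Z ⊆ Y ∩ Y₂ := Finset.subset_inter hZY.1 hZ2.1
            have hun : b₀ + 1 ≤ I.pot i d (Y ∪ Y₂) := by
              refine h1 _ (lt_of_lt_of_le hZY Finset.subset_union_left) ?_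
              refine (Finset.union_subset hYA.1 hA2.1).ssubset_of_ne fun h => ?_
              have := h ▸ (Finset.mem_sdiff.1 hz1A).1
              simp [hz, hz2] at this
            have hss : Z ⊂ Y ∩ Y₂ := by
              refine hZi.ssubset_of_ne fun h => ?_
              rw [← h] at hsub
              linarith
            have hiA : Y ∩ Y₂ ⊂ A := lt_of_le_of_lt Finset.inter_subset_left hYA
            have hpi : I.pot i d (Y ∩ Y₂) = b₀ + 1 := le_antisymm (by linarith) (h1 _ hss hiA)
            have hle := hmin (Y ∩ Y₂) ⟨hiA.1, ⟨hss, hiA, hpi⟩, by simp [hz]⟩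
            have heq : Y ∩ Y₂ = Y₂ := Finset.eq_of_subset_of_card_le Finset.inter_subset_right hle
            have : z₂ ∈ Y ∩ Y₂ := by rw [heq]; exact (Finset.mem_sdiff.1 hz2Y).1
            exact ⟨z₂, by simp [(Finset.mem_inter.1 this).1, (Finset.mem_sdiff.1 hz2Y).2], by simp⟩
      · push Not at hex2
        refine ⟨fun y => if y = z₁ then 1 else 0, fun y _ => ?_, ?_, fun _ Y hZY hYA hpY =>
          ⟨z₁, ?_, by simp⟩⟩
        · dsimp only
          split_ifs with h
          · subst h; assumption
          · exact Nat.zero_le _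
        · have := h6 hpZ
          simp only [Finset.sum_ite_eq', hz1A, if_true]
          omega
        · simp [hex2 Y ⟨hZY, hYA, hpY⟩, (Finset.mem_sdiff.1 hz1).2]
    · refine ⟨fun _ => 0, by simp, by simp, fun hp Y hZY hYA hpY => ?_⟩
      exact absurd ⟨hp, Y, hZY, hYA, hpY⟩ hex
  obtain ⟨u, hu, hus, huc⟩ := exists_extend hu0 hu0s
  have hsplit : ∀ y, ∃ f : (ℕ × ℕ) × (ℕ × ℕ), f.1.1 ≤ I.r x y false ∧ f.1.2 ≤ I.r x y true ∧
      f.2.1 ≤ I.h x y false ∧ f.2.2 ≤ I.h x y true ∧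
      f.1.1 + f.1.2 + (f.2.1 + f.2.2) = min (u y) (U y) :=
    fun y => exists_split _ _ _ _ _ (min_le_right _ _)
  choose f f1 f2 f3 f4 f5 using hsplit
  have hsum : ∀ X : Finset V, ∀ y ∈ X, ∑ s ∈ Z, (i * (((if s = x then (f y).1.1 else 0 : ℕ) : ℤ)
      + ((if s = x then (f y).1.2 else 0 : ℕ) : ℤ))
      + (((if s = x then (f y).2.1 else 0 : ℕ) : ℤ) + ((if s = x then (f y).2.2 else 0 : ℕ) : ℤ)))
      = i * ((f y).1.1 + (f y).1.2) + ((f y).2.1 + (f y).2.2) := by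
    intro X y _
    rw [Finset.sum_eq_single_of_mem x hx]
    · simp
    · intro s _ hs; simp [hs]
  have hgain : ∀ X ⊆ A \ Z, ∑ y ∈ X, (u y : ℤ)
      ≤ ∑ y ∈ X, (i * (((f y).1.1 : ℤ) + (f y).1.2) + ((f y).2.1 + (f y).2.2)) := by
    intro X hX
    refine Finset.sum_le_sum fun y hy => ?_
    have e := f5 y
    rw [min_eq_left (hu y (hX hy)).2] at e
    have : (u y : ℤ) = (f y).1.1 + (f y).1.2 + ((f y).2.1 + (f y).2.2) := by
      rw [← e]; push_cast; ring
    rw [this]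
    have : (0 : ℤ) ≤ (f y).1.1 + (f y).1.2 := by positivity
    nlinarith
  refine colorable_of_resid_pot (by linarith) hd hadm ih hZ.1 ⟨x, hx⟩
    (φ := φ) (o := o)
    (fr := fun s y b => if s = x then bif b then (f y).1.2 else (f y).1.1 else 0)
    (fh := fun s y b => if s = x then bif b then (f y).2.2 else (f y).2.1 else 0)
    ?_ ?_ g1 g2 ?_ ?_
  · intro s y b
    by_cases hs : s = x
    · subst hs
      cases b
      · simpa using f1 y
      · simpa using f2 y
    · simp [hs]
  · intro s y b
    by_cases hs : s = x
    · subst hs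
      cases b
      · simpa using f3 y
      · simpa using f4 y
    · simp [hs]
  · intro y hy
    by_cases hyx : y = x
    · subst hyx
      refine le_trans ?_ g4
      refine add_le_add_right ?_ _
      refine le_trans (le_of_eq ?_) (Nat.cast_le.2 hus)
      push_cast
      refine Finset.sum_congr rfl fun z hz => ?_
      have e := f5 z
      rw [min_eq_left (hu z hz).2] at e
      simp only [if_true, cond_false, cond_true]
      rw [← e]; push_cast; ring
    · simpa [hyx] using g3 y hy
  · intro X hX hXn
    simp only [cond_false, cond_true]
    rw [Finset.sum_congr rfl (hsum X)]
    have hXg := hgain X hX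
    have hd1 : Disjoint Z X := Finset.disjoint_of_subset_right hX Finset.disjoint_sdiff
    by_cases hXA : X = A \ Z
    · subst hXA
      rw [Finset.union_sdiff_of_subset hZ.1]
      rcases huc with huc | huc
      · have : (∑ y ∈ A \ Z, (u y : ℤ)) = κ := by exact_mod_cast huc
        linarith
      · have : ∑ y ∈ A \ Z, (i * (I.R x y : ℤ) + I.H x y)
            = ∑ y ∈ A \ Z, (i * (((f y).1.1 : ℤ) + (f y).1.2) + ((f y).2.1 + (f y).2.2)) := by
          refine Finset.sum_congr rfl fun y hy => ?_
          have e := f5 y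
          rw [huc y hy, min_self] at e
          have e1 := f1 y
          have e2 := f2 y
          have e3 := f3 y
          have e4 := f4 y
          simp only [hU, R, H] at e ⊢
          have a1 : (f y).1.1 = I.r x y false := by omega
          have a2 : (f y).1.2 = I.r x y true := by omega
          have a3 : (f y).2.1 = I.h x y false := by omega
          have a4 : (f y).2.2 = I.h x y true := by omega
          rw [a1, a2, a3, a4]
          push_cast; ring
        linarith
    · have hYA : Z ∪ X ⊂ A := by
        refine (Finset.union_subset hZ.1 (hX.trans Finset.sdiff_subset)).ssubset_of_ne fun h => ?_
        apply hXA
        rw [← h, Finset.union_sdiff_left, Finset.sdiff_eq_self_of_disjoint hd1.symm]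
      have hZY : Z ⊂ Z ∪ X := by
        refine Finset.subset_union_left.ssubset_of_ne fun h => ?_
        obtain ⟨y, hy⟩ := hXn
        have : y ∈ Z := h ▸ Finset.mem_union_right _ hy
        exact Finset.disjoint_left.1 hd1 this hy
      have hb := h1 _ hZY hYA
      have hu0 : (0 : ℤ) ≤ ∑ y ∈ X, (u y : ℤ) := by positivity
      by_cases hcase : I.pot i d Z = b₀ + 2 ∧ I.pot i d (Z ∪ X) = b₀ + 1
      · obtain ⟨y, hy, hy0⟩ := hu0b hcase.1 _ hZY hYA hcase.2
        have hyX : y ∈ X := by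
          simp only [Finset.mem_sdiff, Finset.mem_union] at hy
          tauto
        have : (u y : ℤ) ≤ ∑ y ∈ X, (u y : ℤ) :=
          Finset.single_le_sum (f := fun y => (u y : ℤ)) (fun y _ => by positivity) hyX
        have h7 := (hu y (hX hyX)).1
        omega
      · omega

/-! ### Forbidden rich nodes and partial colourings -/

lemma sum_R_nonneg (x : V) (S : Finset V) : (0 : ℤ) ≤ ∑ y ∈ S, (I.R x y : ℤ) :=
  Finset.sum_nonneg fun _ _ => by positivity

lemma sum_H_nonneg (x : V) (S : Finset V) : (0 : ℤ) ≤ ∑ y ∈ S, (I.H x y : ℤ) :=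
  Finset.sum_nonneg fun _ _ => by positivity

lemma sum_q (x : V) (S : Finset V) :
    ∑ y ∈ S, I.q i x y = (i + 1) * ∑ y ∈ S, (I.R x y : ℤ) + ∑ y ∈ S, (I.H x y : ℤ) := by
  rw [Finset.mul_sum, ← Finset.sum_add_distrib]
  rfl

lemma sum_iR_add_H (x : V) (S : Finset V) :
    ∑ y ∈ S, (i * (I.R x y : ℤ) + I.H x y)
      = i * ∑ y ∈ S, (I.R x y : ℤ) + ∑ y ∈ S, (I.H x y : ℤ) := by
  rw [Finset.mul_sum, ← Finset.sum_add_distrib]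

lemma pot_erase {S : Finset V} {x : V} (hx : x ∈ S) :
    I.pot i d S = I.pot i d (S.erase x) + I.w i d x - ∑ y ∈ S.erase x, I.q i x y := by
  rw [← pot_insert (Finset.notMem_erase x S), Finset.insert_erase hx]

lemma colorable_singleton {x : V} (h : 0 ≤ I.c x false) : I.Colorable {x} :=
  ⟨fun _ => false, fun _ _ => 0, by simp, by simp [I.h_self], by simpa [I.r_self] using h⟩

/-- In an uncolourable instance all of whose smaller instances are colourable no rich node is
forbidden. -/
lemma n_eq_zero_of_not_colorable (hi : 1 ≤ i) (hi2 : i ≤ 2) (hd : 0 ≤ d) (hadm : I.Adm i d A)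
    (ih : ColorableBelow V i d A.card) (hnot : ¬ I.Colorable A) {x : V} (hx : x ∈ A) :
    I.n x = 0 := by
  by_contra hn
  obtain ⟨hc0, hc1⟩ := hadm.1 x hx
  have hn1 : (1 : ℤ) ≤ I.n x := by exact_mod_cast Nat.one_le_iff_ne_zero.2 hn
  have hw := (hadm.2 {x} (by simpa using hx) (by simp)).2 ⟨x, by simp, hn⟩
  rw [pot_singleton] at hw
  have hwc : I.w i d x ≤ I.c x false := by unfold w; nlinarith
  by_cases hA : A = {x}
  · exact hnot (hA ▸ colorable_singleton (by linarith))
  have hZ : {x} ⊂ A := (Finset.singleton_subset_iff.2 hx).ssubset_of_ne (Ne.symm hA)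
  have hgap := @pot_lt_of_not_colorable V _ I i d A (by linarith) hd hadm ih hnot
  have hpA := (hadm.2 A le_rfl ⟨x, hx⟩).2 ⟨x, hx, hn⟩
  have hκ : ((I.c x false).toNat : ℤ) = I.c x false := Int.toNat_of_nonneg (by linarith)
  have hne : (A.erase x).Nonempty := by
    obtain ⟨y, hy, hyx⟩ := Finset.exists_of_ssubset hZ
    exact ⟨y, by simpa [hy] using hyx⟩
  refine hnot (colorable_of_spare hi hd hadm ih hZ (Finset.mem_singleton_self x)
    (φ := fun _ => false) (o := fun _ _ => 0) (κ := (I.c x false).toNat) (b₀ := 0)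
    (by simp) (by simp [I.h_self]) ?_ ?_ ?_ ?_ ?_ ?_ ?_ ?_)
  · simpa [load, I.r_self] using (by linarith : 0 ≤ I.c x false)
  · simp [load, I.r_self, hκ]
  · intro Y hY hYA
    have := hgap hYA ((Finset.singleton_nonempty x).mono hY.1)
    linarith
  · rw [pot_singleton]; linarith
  · intro h2 Y hY hYA hp
    rw [pot_singleton] at h2
    have hxY : x ∈ Y := hY.1 (Finset.mem_singleton_self x)
    have hneY : (Y.erase x).Nonempty := by
      obtain ⟨y, hy, hyx⟩ := Finset.exists_of_ssubset hY
      exact ⟨y, by simpa [hy] using hyx⟩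
    have := hgap (lt_of_le_of_lt (Finset.erase_subset x Y) hYA) hneY
    have := pot_erase (I := I) (i := i) (d := d) hxY
    rw [Finset.sdiff_singleton_eq_erase]
    linarith
  · rw [pot_singleton, hκ]; linarith
  · have h1 := hgap (Finset.erase_ssubset hx) hne
    have h2 := pot_erase (I := I) (i := i) (d := d) hx
    rw [Finset.sdiff_singleton_eq_erase, pot_singleton, sum_iR_add_H]
    rw [sum_q] at h2
    have h3 := sum_R_nonneg (I := I) x (A.erase x)
    have h4 := sum_H_nonneg (I := I) x (A.erase x)
    rcases h3.eq_or_lt with h5 | h5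
    · rw [← h5] at h2 ⊢
      linarith
    · nlinarith
  · rw [pot_singleton]
    intro h
    omega

/-- The instance with other capacities. -/
def withCap (I : Inst V) (c : V → Bool → ℤ) : Inst V := { I with c := c }

/-- A proper subset can be coloured with some capacity left over on prescribed nodes, as long as
its potentials stay admissible. -/
lemma exists_coloring_with_units (hadm : I.Adm i d A)
    (ih : ColorableBelow V i d A.card) (hn : ∀ x ∈ A, I.n x = 0) {W : Finset V} (hW : W ⊂ A)
    (u : V → Bool → ℕ)
    (hu : ∀ S ⊆ W, S.Nonempty → ∑ x ∈ S, ((u x false : ℤ) + u x true) ≤ I.pot i d S + d) :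
    ∃ (φ : V → Bool) (o : V → V → ℕ),
      (∀ x ∈ W, ∀ y ∈ W, I.h x y (φ x ^^ φ y) ≤ o x y + o y x) ∧
      ∀ x ∈ W, I.load φ o W x + u x (φ x) ≤ I.c x (φ x) := by
  obtain ⟨φ, o, -, g2, g3⟩ := ih (I.withCap fun x β => I.c x β - u x β) W (Finset.card_lt_card hW)
    (by
      refine ⟨fun x hx => ?_, fun S hS hSn => ?_⟩
      · have := hadm.1 x (hW.1 hx)
        simp only [withCap]
        omega
      · have e : (I.withCap fun x β => I.c x β - u x β).pot i d S
            = I.pot i d S - ∑ x ∈ S, ((u x false : ℤ) + u x true) := by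
          have : pairSum ((I.withCap fun x β => I.c x β - u x β).q i) S = pairSum (I.q i) S := rfl
          rw [pot, pot, this, sub_sub, add_comm (pairSum _ _), ← sub_sub, ← Finset.sum_sub_distrib]
          congr 1
          refine Finset.sum_congr rfl fun x _ => ?_
          simp only [w, withCap]
          ring
        have := hu S hS hSn
        refine ⟨by linarith, ?_⟩
        rintro ⟨x, hx, hx0⟩
        exact absurd (hn x (hW.1 (hS hx))) hx0)
  refine ⟨φ, o, g2, fun x hx => ?_⟩
  have := g3 x hx
  simp only [withCap] at this
  simp only [load]
  linarith

/-- Extending a partial colouring by one vertex `x`, with node `β`. Of the half edges at `s`, the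
node of `s` takes `m s`, and the node of `x` takes the others. -/
lemma exists_insert {W : Finset V} {x : V} (hx : x ∉ W) {φ : V → Bool} {o : V → V → ℕ}
    (g2 : ∀ x ∈ W, ∀ y ∈ W, I.h x y (φ x ^^ φ y) ≤ o x y + o y x) (β : Bool) (m : V → ℕ) :
    ∃ (φ' : V → Bool) (o' : V → V → ℕ), (∀ s ∈ W, φ' s = φ s) ∧ φ' x = β ∧
      (∀ y ∈ insert x W, ∀ z ∈ insert x W, I.h y z (φ' y ^^ φ' z) ≤ o' y z + o' z y) ∧
      (∀ s ∈ W, I.load φ' o' (insert x W) s = I.load φ o W s + I.r s x (φ s ^^ β) + m s) ∧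
      I.load φ' o' (insert x W) x = ∑ s ∈ W, ((I.r s x (φ s ^^ β) : ℤ)
        + ((I.h s x (φ s ^^ β) - m s : ℕ) : ℤ)) := by
  have hne : ∀ s ∈ W, s ≠ x := fun s hs h => hx (h ▸ hs)
  have hφ : ∀ s ∈ W, Function.update φ x β s = φ s := fun s hs =>
    Function.update_of_ne (hne s hs) _ _
  refine ⟨Function.update φ x β, fun s y => if s = x then
    (if y = x then 0 else I.h y x (φ y ^^ β) - m y) else if y = x then m s else o s y,
    hφ, Function.update_self _ _ _, ?_, ?_, ?_⟩
  · intro y hy z hz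
    rw [Finset.mem_insert] at hy hz
    rcases hy with rfl | hy <;> rcases hz with rfl | hz
    · simp [I.h_self]
    · simp only [if_true, hne z hz, if_false, hφ z hz, Function.update_self]
      rw [I.h_symm y z, Bool.xor_comm]
      omega
    · simp only [if_true, hne y hy, if_false, hφ y hy, Function.update_self]
      omega
    · simpa [hne y hy, hne z hz] using g2 y hy z hz
  · intro s hs
    have : ∑ y ∈ W, ((I.r s y (φ s ^^ Function.update φ x β y) : ℤ)
        + ((if s = x then (if y = x then 0 else I.h y x (φ y ^^ β) - m y)
          else if y = x then m s else o s y : ℕ) : ℤ)) = I.load φ o W s :=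
      Finset.sum_congr rfl fun y hy => by simp [hne s hs, hne y hy]
    rw [load, Finset.sum_insert hx, hφ s hs, this]
    simp only [hne s hs, if_true, if_false, Function.update_self]
    ring
  · rw [load, Finset.sum_insert hx]
    simp only [Function.update_self, if_true, I.r_self, Nat.cast_zero, zero_add]
    refine Finset.sum_congr rfl fun s hs => ?_
    simp only [hne s hs, if_false, hφ s hs]
    rw [I.r_symm x s, Bool.xor_comm]

lemma colorable_of_erase {x : V} (hx : x ∈ A) (hn : ∀ x ∈ A, I.n x = 0) {φ : V → Bool}
    {o : V → V → ℕ}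
    (g2 : ∀ y ∈ A.erase x, ∀ z ∈ A.erase x, I.h y z (φ y ^^ φ z) ≤ o y z + o z y) (β : Bool)
    (m : V → ℕ) (h1 : ∀ s ∈ A.erase x,
      I.load φ o (A.erase x) s + I.r s x (φ s ^^ β) + m s ≤ I.c s (φ s))
    (h2 : ∑ s ∈ A.erase x, ((I.r s x (φ s ^^ β) : ℤ) + ((I.h s x (φ s ^^ β) - m s : ℕ) : ℤ))
      ≤ I.c x β) : I.Colorable A := by
  obtain ⟨φ', o', a1, a2, a3, a4, a5⟩ := exists_insert (Finset.notMem_erase x A) g2 β m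
  rw [Finset.insert_erase hx] at a3 a4 a5
  refine ⟨φ', o', fun y hy _ => hn y hy, a3, fun y hy => ?_⟩
  change I.load φ' o' A y ≤ I.c y (φ' y)
  by_cases hyx : y = x
  · subst hyx
    rw [a2]
    exact a5.le.trans h2
  · have hy' := Finset.mem_erase.2 ⟨hyx, hy⟩
    rw [a1 y hy']
    exact (a4 y hy').le.trans (h1 y hy')

/-! ### Vertices with two edges -/

/-- The instance with one more half edge, of sign `b`, between `s` and `t`. -/
def addHalf (I : Inst V) (s t : V) (hst : s ≠ t) (b : Bool) : Inst V where
  c := I.c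
  n := I.n
  r := I.r
  h x y β := I.h x y β + if (x = s ∧ y = t ∨ x = t ∧ y = s) ∧ β = b then 1 else 0
  r_symm := I.r_symm
  h_symm x y β := by
    rw [I.h_symm]
    congr 2
    simp only [eq_iff_iff]
    tauto
  r_self := I.r_self
  h_self x β := by
    rw [I.h_self, if_neg]
    rintro ⟨⟨rfl, h⟩ | ⟨rfl, h⟩, -⟩
    · exact hst h
    · exact hst h.symm
  r_le := I.r_le

lemma addHalf_pot {s t : V} (hst : s ≠ t) (b : Bool) (S : Finset V) :
    (I.addHalf s t hst b).pot i d S = I.pot i d S - if s ∈ S ∧ t ∈ S then 1 else 0 := by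
  have h3 : ∀ x y, (I.addHalf s t hst b).q i x y = I.q i x y
      + ((if x = s then if y = t then 1 else 0 else 0)
        + (if x = t then if y = s then 1 else 0 else 0)) := by
    intro x y
    have e : ((if (x = s ∧ y = t ∨ x = t ∧ y = s) ∧ false = b then 1 else 0 : ℕ)
        + (if (x = s ∧ y = t ∨ x = t ∧ y = s) ∧ true = b then 1 else 0 : ℕ) : ℤ)
        = (if x = s then if y = t then 1 else 0 else 0)
        + (if x = t then if y = s then 1 else 0 else 0) := by
      by_cases hxs : x = s
      · subst hxs
        cases b <;> simp [hst]
      · cases b <;> simp [hxs, ← ite_and]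
    simp only [q, R, H, addHalf] at *
    rw [← e]
    push_cast
    ring
  have h4 : (I.addHalf s t hst b).q i = fun x y => I.q i x y
      + ((if x = s then if y = t then 1 else 0 else 0)
        + (if x = t then if y = s then 1 else 0 else 0)) := funext₂ h3
  have hw : ∀ x, (I.addHalf s t hst b).w i d x = I.w i d x := fun x => rfl
  simp only [pot, h4, hw, pairSum_add_pair q_symm q_self hst]
  ring

/-- A vertex of full capacity that meets exactly two edges, and no half edges, can be replaced by a
half edge between its neighbours: if that half edge is inactive then some node of the vertex has no
conflict, and otherwise the vertex takes a node in conflict with the neighbour loaded by the half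
edge. -/
lemma w_ne_of_sum_R_eq_two (hi : 1 ≤ i) (hd : i ≤ d) (hadm : I.Adm i d A)
    (ih : ColorableBelow V i d A.card) (hnot : ¬ I.Colorable A)
    (hn : ∀ x ∈ A, I.n x = 0) {x : V} (hx : x ∈ A)
    (hR : ∑ y ∈ A.erase x, (I.R x y : ℤ) = 2) (hH : ∑ y ∈ A.erase x, (I.H x y : ℤ) = 0) :
    I.w i d x ≠ 2 * i + 1 := by
  intro hw
  obtain ⟨hc0, hc1⟩ := hadm.1 x hx
  have hcx : I.c x false + I.c x true = 2 * i + d := by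
    have := hn x hx
    simp only [w, this] at hw
    push_cast at hw
    linarith
  have hR' : ∑ y ∈ A.erase x, I.R x y = 2 := by exact_mod_cast hR
  have hH0 : ∀ y ∈ A.erase x, I.H x y = 0 := by
    have : ∑ y ∈ A.erase x, I.H x y = 0 := by exact_mod_cast hH
    exact Finset.sum_eq_zero_iff.1 this
  have hRle : ∀ y, I.R x y ≤ 1 := I.r_le x
  -- the two neighbours
  have hcard : ((A.erase x).filter fun y => I.R x y = 1).card = 2 := by
    rw [Finset.card_filter, ← hR']
    refine Finset.sum_congr rfl fun y _ => ?_
    have := hRle y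
    split_ifs <;> omega
  obtain ⟨s, t, hst, heq⟩ := Finset.card_eq_two.1 hcard
  have hs : s ∈ A.erase x ∧ I.R x s = 1 := by
    have : s ∈ ({s, t} : Finset V) := by simp
    rw [← heq, Finset.mem_filter] at this
    exact this
  have ht : t ∈ A.erase x ∧ I.R x t = 1 := by
    have : t ∈ ({s, t} : Finset V) := by simp
    rw [← heq, Finset.mem_filter] at this
    exact this
  have hother : ∀ y ∈ A.erase x, y ≠ s → y ≠ t → I.R x y = 0 := by
    intro y hy hys hyt
    by_contra h0
    have := hRle y
    have : y ∈ ({s, t} : Finset V) := by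
      rw [← heq, Finset.mem_filter]
      exact ⟨hy, by omega⟩
    simp [hys, hyt] at this
  have hsgn : ∀ y, I.R x y = 1 → ∃ b, ∀ β, I.r y x β = if β = b then 1 else 0 := by
    intro y hy
    simp only [R, I.r_symm x y] at hy
    rcases Nat.add_eq_one_iff.1 hy with h | h
    · exact ⟨true, fun β => by cases β <;> simp [h.1, h.2]⟩
    · exact ⟨false, fun β => by cases β <;> simp [h.1, h.2]⟩
  obtain ⟨b₁, hb1⟩ := hsgn s hs.2
  obtain ⟨b₂, hb2⟩ := hsgn t ht.2
  obtain ⟨φ, o, -, g2, g3⟩ := ih (I.addHalf s t hst !(b₁ ^^ b₂)) (A.erase x)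
    (Finset.card_erase_lt_of_mem hx) (by
      refine ⟨fun y hy => hadm.1 y (Finset.erase_subset _ _ hy), fun S hS hSn => ⟨?_, ?_⟩⟩
      · rw [addHalf_pot]
        have hSA := hS.trans (Finset.erase_subset x A)
        have hp := (hadm.2 S hSA hSn).1
        split_ifs with hm
        · have hxS : x ∉ S := fun h => (Finset.mem_erase.1 (hS h)).1 rfl
          have hp' := (hadm.2 (insert x S) (Finset.insert_subset hx hSA) (by simp)).1
          rw [pot_insert hxS, sum_q, hw] at hp'
          have h1 : (2 : ℤ) ≤ ∑ y ∈ S, (I.R x y : ℤ) := by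
            have : ∑ y ∈ ({s, t} : Finset V), (I.R x y : ℤ) ≤ ∑ y ∈ S, (I.R x y : ℤ) :=
              Finset.sum_le_sum_of_subset_of_nonneg (by
                intro y hy
                rcases Finset.mem_insert.1 hy with rfl | hy
                · exact hm.1
                · rw [Finset.mem_singleton.1 hy]; exact hm.2) fun _ _ _ => by positivity
            rw [Finset.sum_pair hst, hs.2, ht.2] at this
            simpa using this
          have h2 := sum_H_nonneg (I := I) x S
          nlinarith
        · linarith
      · rintro ⟨y, hy, hy0⟩
        exact absurd (hn y (Finset.erase_subset _ _ (hS hy))) hy0)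
  have hload : ∀ y ∈ A.erase x, I.load φ o (A.erase x) y ≤ I.c y (φ y) := g3
  -- it suffices to find a node with at most one conflict, at a neighbour that has room for it
  have key : ∀ (p : V → V → ℕ) (β : Bool),
      (∀ y ∈ A.erase x, ∀ z ∈ A.erase x, I.h y z (φ y ^^ φ z) ≤ p y z + p z y) →
      (∀ y ∈ A.erase x, I.load φ p (A.erase x) y + I.r y x (φ y ^^ β) ≤ I.c y (φ y)) →
      ∑ y ∈ A.erase x, (I.r y x (φ y ^^ β) : ℤ) ≤ 1 → I.Colorable A := by
    intro p β k1 k2 k3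
    refine colorable_of_erase hx hn k1 β (fun _ => 0) (by simpa using k2) ?_
    have h0 : ∀ y ∈ A.erase x, ∀ b, I.h y x b = 0 := by
      intro y hy b
      have := hH0 y hy
      simp only [H, I.h_symm x y] at this
      cases b <;> omega
    rw [Finset.sum_congr rfl fun y hy => by rw [h0 y hy]]
    simp only [Nat.zero_sub, Nat.cast_zero, add_zero]
    refine k3.trans ?_
    cases β <;> linarith
  have hr0 : ∀ y ∈ A.erase x, y ≠ s → y ≠ t → ∀ b, I.r y x b = 0 := by
    intro y hy hys hyt b
    have := hother y hy hys hyt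
    simp only [R, I.r_symm x y] at this
    cases b <;> omega
  have hsum : ∀ β, ∑ y ∈ A.erase x, (I.r y x (φ y ^^ β) : ℤ)
      = I.r s x (φ s ^^ β) + I.r t x (φ t ^^ β) := by
    intro β
    rw [← Finset.sum_pair (f := fun y => (I.r y x (φ y ^^ β) : ℤ)) hst]
    symm
    refine Finset.sum_subset ?_ fun y hy hy' => ?_
    · intro y hy
      rcases Finset.mem_insert.1 hy with rfl | hy
      · exact hs.1
      · rw [Finset.mem_singleton.1 hy]; exact ht.1
    · simp only [Finset.mem_insert, Finset.mem_singleton, not_or] at hy'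
      simp [hr0 y hy hy'.1 hy'.2]
  have hg2 : ∀ y ∈ A.erase x, ∀ z ∈ A.erase x, I.h y z (φ y ^^ φ z) ≤ o y z + o z y :=
    fun y hy z hz => (Nat.le_add_right _ _).trans (g2 y hy z hz)
  by_cases hact : (φ s ^^ b₁) = (φ t ^^ b₂)
  · refine hnot (key o (!(φ s ^^ b₁)) hg2 (fun y hy => ?_) ?_)
    · have : I.r y x (φ y ^^ !(φ s ^^ b₁)) = 0 := by
        by_cases hys : y = s
        · subst hys
          rw [hb1, if_neg]
          cases φ y <;> cases b₁ <;> simp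
        · by_cases hyt : y = t
          · subst hyt
            rw [hact, hb2, if_neg]
            cases φ y <;> cases b₂ <;> simp
          · exact hr0 y hy hys hyt _
      rw [this]
      simpa using hload y hy
    · rw [hsum, hb1, hb2, if_neg, if_neg]
      · simp
      · rw [hact]; cases φ t <;> cases b₂ <;> simp
      · cases φ s <;> cases b₁ <;> simp
  · have hh : I.h s t (φ s ^^ φ t) + 1 ≤ o s t + o t s := by
      have := g2 s hs.1 t ht.1
      simp only [addHalf, and_self, true_or, true_and] at this
      rwa [if_pos] at this
      revert hact
      cases φ s <;> cases φ t <;> cases b₁ <;> cases b₂ <;> simp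
    -- the argument is symmetric in `s` and `t`
    have main : ∀ (s t : V) (b₁ b₂ : Bool), s ≠ t → s ∈ A.erase x → t ∈ A.erase x →
        (∀ β, I.r s x β = if β = b₁ then 1 else 0) → (∀ β, I.r t x β = if β = b₂ then 1 else 0) →
        (∀ y ∈ A.erase x, y ≠ s → y ≠ t → ∀ b, I.r y x b = 0) →
        (∀ β, ∑ y ∈ A.erase x, (I.r y x (φ y ^^ β) : ℤ)
          = I.r s x (φ s ^^ β) + I.r t x (φ t ^^ β)) → (φ s ^^ b₁) ≠ (φ t ^^ b₂) →
        I.h s t (φ s ^^ φ t) + 1 ≤ o s t + o t s → o s t ≠ 0 → I.Colorable A := by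
      intro s t b₁ b₂ hst hs ht hb1 hb2 hr0 hsum hact hh ho
      have hrt : I.r t x (φ t ^^ (φ s ^^ b₁)) = 0 := by
        rw [hb2, if_neg]
        revert hact
        cases φ s <;> cases φ t <;> cases b₁ <;> cases b₂ <;> simp
      have hrs : I.r s x (φ s ^^ (φ s ^^ b₁)) = 1 := by
        rw [hb1, if_pos]
        cases φ s <;> cases b₁ <;> simp
      refine key (fun y z => if y = s ∧ z = t then o s t - 1 else o y z) (φ s ^^ b₁)
        (fun y hy z hz => ?_) (fun y hy => ?_) ?_
      · by_cases h1 : y = s ∧ z = t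
        · obtain ⟨rfl, rfl⟩ := h1
          have : ¬ (z = y ∧ y = z) := fun h => hst h.2
          simp only [and_self, if_true, this, if_false]
          omega
        · by_cases h2 : z = s ∧ y = t
          · obtain ⟨rfl, rfl⟩ := h2
            simp only [and_self, if_true, h1, if_false]
            rw [I.h_symm, Bool.xor_comm]
            omega
          · simp only [h1, h2, if_false]
            exact hg2 y hy z hz
      · by_cases hys : y = s
        · subst hys
          rw [hrs]
          refine le_trans (le_of_eq ?_) (hload y hy)
          have e : ∀ z, (((if y = y ∧ z = t then o y t - 1 else o y z : ℕ)) : ℤ)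
              = o y z - if z = t then 1 else 0 := by
            intro z
            by_cases hz : z = t
            · subst hz
              simp only [and_self, if_true]
              rw [Nat.cast_sub (by omega)]; simp
            · simp [hz]
          have e3 : I.load φ (fun u z => if u = y ∧ z = t then o y t - 1 else o u z) (A.erase x) y
              = ∑ z ∈ A.erase x, ((I.r y z (φ y ^^ φ z) : ℤ) + (o y z - if z = t then 1 else 0)) :=
            Finset.sum_congr rfl fun z _ => by rw [e]
          rw [e3]
          simp only [load, Finset.sum_add_distrib, Finset.sum_sub_distrib, Finset.sum_ite_eq', ht,
            if_true]
          push_cast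
          ring
        · have e : I.load φ (fun y z => if y = s ∧ z = t then o s t - 1 else o y z) (A.erase x) y
              = I.load φ o (A.erase x) y := by simp only [load, hys, false_and, if_false]
          have e2 : I.r y x (φ y ^^ (φ s ^^ b₁)) = 0 := by
            by_cases hyt : y = t
            · rw [hyt]; exact hrt
            · exact hr0 y hy hys hyt _
          rw [e, e2]
          simpa using hload y hy
      · rw [hsum, hrs, hrt]
        simp
    by_cases ho : o s t = 0
    · refine hnot (main t s b₂ b₁ hst.symm ht.1 hs.1 hb2 hb1 (fun y hy a b => hr0 y hy b a)
        (fun β => by rw [hsum, add_comm]) (Ne.symm hact) ?_ (by omega))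
      rw [I.h_symm, Bool.xor_comm, add_comm (o t s)]
      exact hh
    · exact hnot (main s t b₁ b₂ hst hs.1 ht.1 hb1 hb2 hr0 hsum hact hh ho)

/-! ### Sets of low potential -/

/-- If no edges, but possibly half edges, leave a set `W` whose potential exceeds those of the larger
sets by at most `d`, then `W` can be coloured first: no rich node becomes forbidden, so residual
potentials down to `-d` are admissible. -/
lemma colorable_of_no_edges (hi : 0 ≤ i) (hadm : I.Adm i d A)
    (ih : ColorableBelow V i d A.card) (hn : ∀ x ∈ A, I.n x = 0) {W : Finset V} (hW : W ⊂ A)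
    (hWn : W.Nonempty) (h0 : ∀ s ∈ W, ∀ x ∈ A \ W, I.R s x = 0)
    (hp : ∀ X ⊆ A \ W, X.Nonempty → I.pot i d W ≤ I.pot i d (W ∪ X) + d) : I.Colorable A := by
  obtain ⟨φ, o, g1, g2, g3⟩ := ih I W (Finset.card_lt_card hW) (hadm.mono hW.1)
  refine colorable_of_resid hi hW.1 (fun x hx => (hadm.1 x hx).1) (fr := fun _ _ _ => 0)
    (fh := fun _ _ _ => 0) (by simp) (by simp) g1 g2 (by simpa using g3) (ih _ _ ?_ ⟨?_, ?_⟩)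
  · rw [Finset.card_sdiff_of_subset hW.1]
    have := Finset.card_le_card hW.1
    have := hWn.card_pos
    omega
  · have hc : ∀ x β, (I.resid i W φ (fun _ _ _ => 0) (fun _ _ _ => 0)).c x β ≤ I.c x β :=
      fun x β => (resid_c_le hi (by simp) x β).trans
        (sub_le_self _ (Finset.sum_nonneg fun s _ => by simp))
    intro x hx
    have := hadm.1 x (Finset.mem_sdiff.1 hx).1
    exact ⟨(hc x _).trans this.1, (hc x _).trans this.2⟩
  · intro S hS hSn
    rw [resid_pot (by simp) (Finset.disjoint_of_subset_right hS Finset.disjoint_sdiff)]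
    have := hp S hS hSn
    refine ⟨by simp; linarith, ?_⟩
    rintro ⟨x, hx, hx0⟩
    refine absurd ?_ hx0
    have hxA := hS hx
    simp only [resid, Nat.add_eq_zero_iff, Finset.sum_eq_zero_iff]
    refine ⟨hn x (Finset.mem_sdiff.1 hxA).1, fun s hs => ?_⟩
    have := h0 s hs x hxA
    simp only [R] at this
    cases (φ s ^^ true) <;> omega

lemma w_le (hadm : I.Adm i d A) (hn : ∀ x ∈ A, I.n x = 0) {x : V} (hx : x ∈ A) :
    I.w i d x = I.c x false + I.c x true + 1 - d ∧ I.w i d x ≤ 2 * i + 1 := by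
  have := hadm.1 x hx
  have h : I.w i d x = I.c x false + I.c x true + 1 - d := by simp [w, hn x hx]
  exact ⟨h, by linarith⟩

lemma sum_h_le_H (x : V) (S : Finset V) (f : V → Bool) :
    ∑ y ∈ S, (I.h y x (f y) : ℤ) ≤ ∑ y ∈ S, (I.H x y : ℤ) := by
  refine Finset.sum_le_sum fun y _ => ?_
  rw [H, I.h_symm y x]
  cases f y <;> push_cast <;> linarith

/-- In an uncolourable instance all of whose smaller instances are colourable, every proper
nonempty subset exceeds the least possible potential by at least two. Otherwise take a largest set
`W` for which this fails and an edge from `s ∈ W` to an outer vertex `x`. Colour `W` with a unit of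
capacity left on the node of `s` from which the edge reaches the poor node of `x`. Either that node
is chosen and `s` has spare capacity, or the edge forbids the poor node of `x`, and giving `x` its
rich node leaves much spare capacity there. -/
lemma two_le_pot_add (hi : 1 ≤ i) (hi2 : i ≤ 2) (hd : i ≤ d) (hadm : I.Adm i d A)
    (ih : ColorableBelow V i d A.card) (hnot : ¬ I.Colorable A)
    (hn : ∀ x ∈ A, I.n x = 0) {S : Finset V} (hS : S ⊂ A) (hSn : S.Nonempty) :
    2 ≤ I.pot i d S + d := by
  by_contra hlt
  have hgap := @pot_lt_of_not_colorable V _ I i d A (by linarith) (by linarith) hadm ih hnot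
  have hpA0 := (hadm.2 A le_rfl (hSn.mono hS.1)).1
  have hSA := hgap hS hSn
  have hpA : I.pot i d A = -d := by omega
  -- a largest proper set of potential `1 - d`
  obtain ⟨W, hW, hmax⟩ := Finset.exists_max_image
    (A.powerset.filter fun W => W.Nonempty ∧ W ⊂ A ∧ I.pot i d W = 1 - d) Finset.card
    ⟨S, by simp only [Finset.mem_filter, Finset.mem_powerset]; exact ⟨hS.1, hSn, hS, by omega⟩⟩
  simp only [Finset.mem_filter, Finset.mem_powerset] at hW hmax
  obtain ⟨-, hWn, hWA, hpW⟩ := hW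
  have hbig : ∀ Y, W ⊂ Y → Y ⊂ A → 2 - d ≤ I.pot i d Y := by
    intro Y hWY hYA
    have h1 := hgap hYA (hWn.mono hWY.1)
    by_contra h2
    have := hmax Y ⟨hYA.1, hWn.mono hWY.1, hYA, by omega⟩
    have := Finset.card_lt_card hWY
    omega
  by_cases hE : ∀ s ∈ W, ∀ x ∈ A \ W, I.R s x = 0
  · refine hnot (colorable_of_no_edges (by linarith) hadm ih hn hWA hWn hE fun X hX hXn => ?_)
    have := (hadm.2 (W ∪ X) (Finset.union_subset hWA.1 (hX.trans Finset.sdiff_subset))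
      (hWn.mono Finset.subset_union_left)).1
    linarith
  push Not at hE
  obtain ⟨s, hs, x, hx, hR⟩ := hE
  obtain ⟨hxA, hxW⟩ := Finset.mem_sdiff.1 hx
  have hRle := I.r_le s x
  obtain ⟨b, hb, hb'⟩ : ∃ b, I.r s x b = 1 ∧ I.r s x (!b) = 0 := by
    simp only [R] at hR
    by_cases h : I.r s x false = 0
    · exact ⟨true, by omega, h⟩
    · exact ⟨false, by omega, by simp only [Bool.not_false]; omega⟩
  have hgap1 : ∀ Y, Y ⊂ A → Y.Nonempty → 1 - d ≤ I.pot i d Y := fun Y hY hYn => by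
    have := hgap hY hYn
    omega
  -- the node of `s` from which the edge would load the poor node of `x` is to be the spare one
  obtain ⟨φ, o, g2, g3⟩ := exists_coloring_with_units hadm ih hn hWA
    (fun y β => if y = s ∧ β = !b then 1 else 0) (by
      intro T hT hTn
      have h1 := hgap1 T (lt_of_le_of_lt hT hWA) hTn
      have h2 : ∑ y ∈ T, (((if y = s ∧ false = !b then 1 else 0 : ℕ) : ℤ)
          + ((if y = s ∧ true = !b then 1 else 0 : ℕ) : ℤ)) ≤ 1 := by
        have : ∀ y ∈ T, (((if y = s ∧ false = !b then 1 else 0 : ℕ) : ℤ)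
          + ((if y = s ∧ true = !b then 1 else 0 : ℕ) : ℤ)) = if y = s then 1 else 0 := by
          intro y _
          by_cases hy : y = s <;> cases b <;> simp [hy]
        rw [Finset.sum_congr rfl this, Finset.sum_ite_eq']
        split_ifs <;> simp
      linarith)
  have g3' : ∀ y ∈ W, I.load φ o W y ≤ I.c y (φ y) := fun y hy => by
    have := g3 y hy
    have : (0 : ℤ) ≤ ((if y = s ∧ φ y = !b then 1 else 0 : ℕ) : ℤ) := by positivity
    linarith
  have hxR : (1 : ℤ) ≤ ∑ y ∈ W, (I.R x y : ℤ) := by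
    have h1 : ((I.R x s : ℕ) : ℤ) ≤ ∑ y ∈ W, (I.R x y : ℤ) :=
      Finset.single_le_sum (f := fun y => (I.R x y : ℤ)) (fun y _ => by positivity) hs
    have h2 : I.R x s ≠ 0 := by rwa [R, I.r_symm, I.r_symm x s true]
    omega
  rcases Bool.eq_or_eq_not (φ s) b with hφ | hφ
  swap
  · refine hnot (colorable_of_spare hi (by linarith) hadm ih hWA hs (κ := 1) (b₀ := 1 - d)
      (fun y hy _ => hn y (hWA.1 hy)) g2 g3' ?_ (fun Y h1 h2 => by have := hbig Y h1 h2; linarith)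
      (by linarith) (fun h => by omega) (by push_cast; linarith) ?_ (fun h => by omega))
    · have := g3 s hs
      rw [if_pos ⟨rfl, hφ⟩] at this
      exact_mod_cast this
    · rw [sum_iR_add_H]
      have h1 : ((I.R s x : ℕ) : ℤ) ≤ ∑ y ∈ A \ W, (I.R s y : ℤ) :=
        Finset.single_le_sum (f := fun y => (I.R s y : ℤ)) (fun y _ => by positivity) hx
      have h2 := sum_H_nonneg (I := I) s (A \ W)
      have : (1 : ℤ) ≤ I.R s x := by omega
      nlinarith
  -- the vertex `x` is to take its rich node
  obtain ⟨hwx, hwx2⟩ := w_le hadm hn hxA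
  have hc0 := (hadm.1 x hxA).1
  have hpZ := pot_insert (I := I) (i := i) (d := d) hxW
  rw [sum_q, hpW] at hpZ
  have hH0 := sum_H_nonneg (I := I) x W
  have hrich : ∑ y ∈ W, (I.R x y : ℤ) = 1 → ∀ y ∈ W, I.r y x (φ y ^^ true) = 0 := by
    intro h1 y hy
    by_cases hys : y = s
    · subst hys
      rw [hφ]
      simpa using hb'
    · have : ∑ z ∈ ({y, s} : Finset V), (I.R x z : ℤ) ≤ ∑ z ∈ W, (I.R x z : ℤ) :=
        Finset.sum_le_sum_of_subset_of_nonneg (by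
          intro z hz
          rcases Finset.mem_insert.1 hz with rfl | hz
          · exact hy
          · rw [Finset.mem_singleton.1 hz]; exact hs) fun _ _ _ => by positivity
      rw [Finset.sum_pair hys, h1] at this
      have h2 : I.R x s ≠ 0 := by rwa [R, I.r_symm, I.r_symm x s true]
      have h3 : I.R x y = 0 := by omega
      simp only [R, I.r_symm x y] at h3
      cases (φ y ^^ true) <;> omega
  obtain ⟨φ', o', a1, a2, a3, a4, a5⟩ := exists_insert hxW g2 true fun _ => 0
  have hloadx : ∑ y ∈ W, (I.R x y : ℤ) = 1 →
      I.load φ' o' (insert x W) x ≤ ∑ y ∈ W, (I.H x y : ℤ) := by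
    intro h1
    rw [a5]
    refine le_trans (Finset.sum_le_sum fun y hy => ?_) (sum_h_le_H x W fun y => φ y ^^ true)
    rw [hrich h1 y hy]
    simp
  have hloadW : ∑ y ∈ W, (I.R x y : ℤ) = 1 →
      ∀ y ∈ W, I.load φ' o' (insert x W) y ≤ I.c y (φ' y) := by
    intro h1 y hy
    rw [a4 y hy, hrich h1 y hy, a1 y hy]
    simpa using g3' y hy
  by_cases hZA : insert x W = A
  · rw [hZA, hpA] at hpZ
    have hWe : A.erase x = W := by rw [← hZA, Finset.erase_insert hxW]
    have hR2 : ∑ y ∈ W, (I.R x y : ℤ) = 1 ∨ 2 ≤ ∑ y ∈ W, (I.R x y : ℤ) := by omega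
    rcases hR2 with h1 | h2
    · refine hnot ⟨φ', o', fun y hy _ => hn y hy, ?_, fun y hy => ?_⟩
      · rwa [hZA] at a3
      · change I.load φ' o' A y ≤ I.c y (φ' y)
        rw [← hZA] at hy ⊢
        rcases Finset.mem_insert.1 hy with rfl | hy
        · rw [a2]
          have := hloadx h1
          rw [h1] at hpZ
          linarith
        · exact hloadW h1 y hy
    · have h3 : ∑ y ∈ W, (I.R x y : ℤ) = 2 := by nlinarith
      rw [h3] at hpZ
      refine w_ne_of_sum_R_eq_two hi hd hadm ih hnot hn hxA (by rw [hWe, h3]) ?_ ?_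
      · rw [hWe]; linarith
      · linarith
  · have hZ : insert x W ⊂ A := (Finset.insert_subset hxA hWA.1).ssubset_of_ne hZA
    have hWZ : W ⊂ insert x W := Finset.ssubset_insert hxW
    have hZp := hbig _ hWZ hZ
    have h1 : ∑ y ∈ W, (I.R x y : ℤ) = 1 := by nlinarith
    rw [h1] at hpZ
    have hκ : ((i + 1).toNat : ℤ) = i + 1 := Int.toNat_of_nonneg (by linarith)
    have hxZ : x ∈ insert x W := Finset.mem_insert_self x W
    -- removing `x` from a larger set
    have hrem : ∀ Y, insert x W ⊆ Y → I.pot i d Y = I.pot i d (Y.erase x) + I.w i d x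
        - ((i + 1) + ∑ y ∈ W, (I.H x y : ℤ) + ∑ y ∈ Y \ insert x W, I.q i x y) := by
      intro Y hY
      have hd' : Disjoint W (Y \ insert x W) :=
        Finset.disjoint_of_subset_left (Finset.subset_insert x W) Finset.disjoint_sdiff
      have : Y.erase x = W ∪ (Y \ insert x W) := by
        ext z
        simp only [Finset.mem_erase, Finset.mem_union, Finset.mem_sdiff, Finset.mem_insert]
        constructor
        · rintro ⟨h1, h2⟩
          by_cases h3 : z ∈ W <;> simp [h1, h2, h3]
        · rintro (h | ⟨h1, h2⟩)
          · exact ⟨fun e => hxW (e ▸ h), hY (Finset.mem_insert_of_mem h)⟩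
          · tauto
      rw [pot_erase (hY hxZ)]
      conv_lhs => rw [this, Finset.sum_union hd', sum_q x W, h1, ← this]
      ring
    refine hnot (colorable_of_spare hi (by linarith) hadm ih hZ hxZ (φ := φ') (o := o')
      (κ := (i + 1).toNat) (b₀ := 1 - d) (fun y hy _ => hn y (hZ.1 hy)) a3 ?_ ?_
      (fun Y k1 k2 => by have := hbig Y (hWZ.trans k1) k2; linarith) (by linarith) ?_
      (by rw [hκ]; linarith) ?_ (fun _ => by omega))
    · intro y hy
      rcases Finset.mem_insert.1 hy with rfl | hy
      · rw [a2]
        have := hloadx h1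
        linarith
      · exact hloadW h1 y hy
    · rw [a2, hκ]
      have := hloadx h1
      linarith
    · intro k1 Y k2 k3 k4
      have k5 := hrem Y k2.1
      have k6 := hgap1 (Y.erase x) (lt_of_le_of_lt (Finset.erase_subset x Y) k3)
        ⟨s, Finset.mem_erase.2 ⟨fun e => hxW (e ▸ hs), k2.1 (Finset.mem_insert_of_mem hs)⟩⟩
      linarith
    · have k5 := hrem A hZ.1
      have k6 : 2 - d ≤ I.pot i d (A.erase x) := by
        refine hbig _ ?_ (Finset.erase_ssubset hxA)
        obtain ⟨y, hy, hyZ⟩ := Finset.exists_of_ssubset hZ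
        rw [Finset.mem_insert, not_or] at hyZ
        rw [Finset.ssubset_iff]
        exact ⟨y, hyZ.2, Finset.insert_subset (Finset.mem_erase.2 ⟨hyZ.1, hy⟩) fun z hz =>
          Finset.mem_erase.2 ⟨fun e => hxW (e ▸ hz), hWA.1 hz⟩⟩
      rw [sum_q] at k5
      rw [sum_iR_add_H]
      have k7 := sum_R_nonneg (I := I) x (A \ insert x W)
      have k8 := sum_H_nonneg (I := I) x (A \ insert x W)
      have k9 : ∑ y ∈ A \ insert x W, (I.R x y : ℤ) ≤ 1
          ∨ 2 ≤ ∑ y ∈ A \ insert x W, (I.R x y : ℤ) := by omega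
      rcases k9 with k9 | k9
      · linarith
      · nlinarith

end Inst

/-! ### Placing two units under a submodular bound -/

section Units

variable {V : Type*} [DecidableEq V]

lemma exists_greatest_of_union_closed {W : Finset V} {F : Finset V → Prop}
    (hne : ∃ S ⊆ W, F S) (hcl : ∀ S ⊆ W, ∀ T ⊆ W, F S → F T → F (S ∪ T)) :
    ∃ M ⊆ W, F M ∧ ∀ S ⊆ W, F S → S ⊆ M := by
  classical
  obtain ⟨S₀, hS0, hF0⟩ := hne
  obtain ⟨M, hM, hmax⟩ := Finset.exists_max_image (W.powerset.filter F) Finset.card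
    ⟨S₀, by simp [hS0, hF0]⟩
  simp only [Finset.mem_filter, Finset.mem_powerset] at hM hmax
  refine ⟨M, hM.1, hM.2, fun S hS hF => ?_⟩
  have h := hmax (S ∪ M) ⟨Finset.union_subset hS hM.1, hcl S hS M hM.1 hF hM.2⟩
  have h' : M = S ∪ M := Finset.eq_of_subset_of_card_le Finset.subset_union_right h
  rw [h']
  exact Finset.subset_union_left

/-- Some vertex with `H y ≠ 0` is outside all sets of a union-closed family on which `t` is at most
`3`, since the largest of these sets does not carry all of `H`. -/
lemma exists_notMem_of_union_closed {W : Finset V} {t : Finset V → ℤ} {H : V → ℕ}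
    (h3 : ∀ S ⊂ W, ∑ y ∈ S, (H y : ℤ) ≤ t S + 3) (h4 : 4 ≤ t W)
    (h5 : 7 ≤ ∑ y ∈ W, (H y : ℤ)) {F : Finset V → Prop} (hF : ∀ S ⊆ W, F S → t S ≤ 3)
    (hcl : ∀ S ⊆ W, ∀ T ⊆ W, F S → F T → F (S ∪ T)) :
    ∃ y ∈ W, 1 ≤ H y ∧ ∀ S ⊆ W, F S → y ∉ S := by
  have hout : ∀ M ⊆ W, ∑ y ∈ M, (H y : ℤ) ≤ 6 → ∃ y ∈ W, 1 ≤ H y ∧ y ∉ M := by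
    intro M hM hle
    by_contra hcon
    push Not at hcon
    have := Finset.sum_sdiff (f := fun y => (H y : ℤ)) hM
    rw [Finset.sum_eq_zero (s := W \ M) fun y hy => ?_] at this
    · omega
    · by_contra h
      exact (Finset.mem_sdiff.1 hy).2 (hcon y (Finset.mem_sdiff.1 hy).1 (by omega))
  by_cases hex : ∃ S ⊆ W, F S
  · obtain ⟨M, hM, hFM, hg⟩ := exists_greatest_of_union_closed hex hcl
    have ht := hF M hM hFM
    have hne : M ≠ W := fun h => by rw [h] at ht; omega
    obtain ⟨y, hy, hy1, hyM⟩ := hout M hM (by linarith [h3 M (hM.ssubset_of_ne hne)])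
    exact ⟨y, hy, hy1, fun S hS h hyS => hyM (hg S hS h hyS)⟩
  · obtain ⟨y, hy, hy1, -⟩ := hout ∅ (by simp) (by simp)
    exact ⟨y, hy, hy1, fun S hS h => absurd ⟨S, hS, h⟩ hex⟩

/-- Two units can be placed on `W`, each counting twice, without exceeding the submodular bound
`t`: the first outside all sets with `t = 2`, the second outside all sets with `t = 3` that contain
the first. -/
lemma exists_two_units {W : Finset V} {t : Finset V → ℤ} {H : V → ℕ}
    (h1 : ∀ S ⊆ W, 2 ≤ t S)
    (h2 : ∀ S ⊆ W, ∀ T ⊆ W, t (S ∪ T) + t (S ∩ T) ≤ t S + t T)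
    (h3 : ∀ S ⊂ W, ∑ y ∈ S, (H y : ℤ) ≤ t S + 3) (h4 : 4 ≤ t W)
    (h5 : 8 ≤ ∑ y ∈ W, (H y : ℤ)) :
    ∃ m : V → ℕ, (∀ y, m y ≤ H y) ∧ ∑ y ∈ W, (m y : ℤ) = 2 ∧
      ∀ S ⊆ W, ∑ y ∈ S, (2 * m y : ℤ) ≤ t S := by
  obtain ⟨y₁, hy1, hH1, ho1⟩ := exists_notMem_of_union_closed h3 h4 (by linarith)
    (F := fun S => t S ≤ 2) (fun S _ h => by linarith) fun S hS T hT hS2 hT2 => by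
      have := h2 S hS T hT
      have := h1 (S ∩ T) (Finset.inter_subset_left.trans hS)
      linarith
  have ho1' : ∀ S ⊆ W, y₁ ∈ S → 3 ≤ t S := fun S hS hy => by
    by_contra h
    exact ho1 S hS (by linarith) hy
  have hle : ∀ y, ((H y - if y = y₁ then 1 else 0 : ℕ) : ℤ) ≤ H y := fun y =>
    Nat.cast_le.2 (Nat.sub_le _ _)
  obtain ⟨y₂, hy2, hH2, ho2⟩ := exists_notMem_of_union_closed (W := W) (t := t)
    (H := fun y => H y - if y = y₁ then 1 else 0)
    (fun S hS => (Finset.sum_le_sum fun y _ => hle y).trans (h3 S hS)) h4 (by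
      have : ∀ y ∈ W, (H y : ℤ) - (if y = y₁ then 1 else 0)
          ≤ ((H y - if y = y₁ then 1 else 0 : ℕ) : ℤ) := by
        intro y _
        split_ifs <;> omega
      have := Finset.sum_le_sum this
      rw [Finset.sum_sub_distrib, Finset.sum_ite_eq', if_pos hy1] at this
      linarith)
    (F := fun S => y₁ ∈ S ∧ t S ≤ 3) (fun S _ h => h.2) fun S hS T hT hS2 hT2 => by
      have := h2 S hS T hT
      have := ho1' (S ∩ T) (Finset.inter_subset_left.trans hS)
        (Finset.mem_inter.2 ⟨hS2.1, hT2.1⟩)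
      exact ⟨Finset.mem_union_left _ hS2.1, by linarith⟩
  have hsum : ∀ S : Finset V, ∑ y ∈ S, (((if y = y₁ then 1 else 0) + (if y = y₂ then 1 else 0) : ℕ) : ℤ)
      = (if y₁ ∈ S then 1 else 0) + (if y₂ ∈ S then 1 else 0) := by
    intro S
    push_cast
    rw [Finset.sum_add_distrib, Finset.sum_ite_eq', Finset.sum_ite_eq']
  refine ⟨fun y => (if y = y₁ then 1 else 0) + (if y = y₂ then 1 else 0), fun y => ?_, ?_,
    fun S hS => ?_⟩
  · by_cases e2 : y = y₂
    · subst e2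
      simp only [if_true]
      omega
    · by_cases e1 : y = y₁
      · subst e1
        simpa [e2] using hH1
      · simp [e1, e2]
  · rw [hsum, if_pos hy1, if_pos hy2]
    norm_num
  · rw [← Finset.mul_sum, hsum]
    have a1 := h1 S hS
    have a2 := ho1' S hS
    have a3 := ho2 S hS
    by_cases e1 : y₁ ∈ S <;> by_cases e2 : y₂ ∈ S <;> simp only [e1, e2, if_true, if_false]
    · have : ¬ t S ≤ 3 := fun h => a3 ⟨e1, h⟩ e2
      omega
    all_goals omega

end Units

/-! ### The weight of the edges at a vertex -/

namespace Inst

variable {V : Type*} [DecidableEq V] {I : Inst V} {i d : ℤ} {A : Finset V}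

/-- A vertex `x` can be added to a colouring of the other vertices when these have room for either
node of `x` and the conflicts at the two nodes of `x` do not exceed both capacities. -/
lemma colorable_of_erase_of_sum_le (hn : ∀ x ∈ A, I.n x = 0) (hadm : I.Adm i d A) {x : V}
    (hx : x ∈ A) {φ : V → Bool} {o : V → V → ℕ}
    (g2 : ∀ y ∈ A.erase x, ∀ z ∈ A.erase x, I.h y z (φ y ^^ φ z) ≤ o y z + o z y) (m : V → ℕ)
    (hm : ∀ s, m s ≤ I.H x s)
    (h1 : ∀ β, ∀ s ∈ A.erase x, I.load φ o (A.erase x) s + I.r s x (φ s ^^ β) + m s ≤ I.c s (φ s))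
    (h2 : ∑ s ∈ A.erase x, (I.R x s : ℤ) + ∑ s ∈ A.erase x, (I.H x s : ℤ)
      ≤ I.w i d x + d + ∑ s ∈ A.erase x, (m s : ℤ)) : I.Colorable A := by
  by_contra hnot
  have hβ : ∀ β, I.c x β + 1 ≤ ∑ s ∈ A.erase x, ((I.r s x (φ s ^^ β) : ℤ)
      + ((I.h s x (φ s ^^ β) - m s : ℕ) : ℤ)) := by
    intro β
    by_contra hlt
    exact hnot (colorable_of_erase hx hn g2 β m (h1 β) (by linarith))
  have h3 := hβ false
  have h4 := hβ true
  have h5 : ∑ s ∈ A.erase x, (((I.r s x (φ s ^^ false) : ℤ)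
      + ((I.h s x (φ s ^^ false) - m s : ℕ) : ℤ)) + ((I.r s x (φ s ^^ true) : ℤ)
      + ((I.h s x (φ s ^^ true) - m s : ℕ) : ℤ)))
      ≤ ∑ s ∈ A.erase x, ((I.R x s : ℤ) + I.H x s - m s) := by
    refine Finset.sum_le_sum fun s _ => ?_
    have := hm s
    simp only [R, H, I.r_symm x s, I.h_symm x s] at *
    cases φ s <;> simp only [Bool.xor_false, Bool.xor_true, Bool.not_false, Bool.not_true] <;> omega
  simp only [Finset.sum_add_distrib, Finset.sum_sub_distrib] at h3 h4 h5
  have h6 := (w_le hadm hn hx).1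
  linarith

/-- In an uncolourable instance all of whose smaller instances are colourable, every vertex meets
edges of total weight at least twice its own. -/
lemma two_mul_w_le (hi : 1 ≤ i) (hi2 : i ≤ 2) (hd : i ≤ d) (hadm : I.Adm i d A)
    (ih : ColorableBelow V i d A.card) (hnot : ¬ I.Colorable A)
    (hn : ∀ x ∈ A, I.n x = 0) {x : V} (hx : x ∈ A) :
    2 * I.w i d x ≤ ∑ y ∈ A.erase x, I.q i x y := by
  by_contra hQ
  push Not at hQ
  have hW := Finset.erase_ssubset hx
  have hxW := Finset.notMem_erase x A
  obtain ⟨hwx, hwx2⟩ := w_le hadm hn hx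
  have hc0 := (hadm.1 x hx).1
  have ht : ∀ S ⊆ A.erase x, S.Nonempty → 2 ≤ I.pot i d S + d := fun S hS hSn =>
    two_le_pot_add hi hi2 hd hadm ih hnot hn (lt_of_le_of_lt hS hW) hSn
  have htx : ∀ S ⊆ A.erase x, -d ≤ I.pot i d S + I.w i d x
      - ((i + 1) * ∑ y ∈ S, (I.R x y : ℤ) + ∑ y ∈ S, (I.H x y : ℤ)) := by
    intro S hS
    rw [← sum_q, ← pot_insert fun h => hxW (hS h)]
    exact (hadm.2 _ (Finset.insert_subset hx (hS.trans hW.1)) (by simp)).1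
  rw [sum_q] at hQ
  have ha0 := sum_R_nonneg (I := I) x (A.erase x)
  have hb0 := sum_H_nonneg (I := I) x (A.erase x)
  have hcase : ∑ y ∈ A.erase x, (I.R x y : ℤ) = 0 ∨ ∑ y ∈ A.erase x, (I.R x y : ℤ) = 1
    ∨ 2 ≤ ∑ y ∈ A.erase x, (I.R x y : ℤ) := by omega
  rcases hcase with ha | ha | ha
  · -- only half edges: the other vertices are made to take enough of them
    obtain ⟨m, hm, hms, hmt⟩ : ∃ m : V → ℕ, (∀ s, m s ≤ I.H x s) ∧
        ∑ s ∈ A.erase x, (I.H x s : ℤ) ≤ I.w i d x + d + ∑ s ∈ A.erase x, (m s : ℤ) ∧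
        ∀ S ⊆ A.erase x, S.Nonempty → ∑ y ∈ S, (2 * m y : ℤ) ≤ I.pot i d S + d := by
      rw [ha] at hQ
      have hu : ∑ y ∈ A.erase x, (I.H x y : ℤ) ≤ I.w i d x + d
          ∨ ∑ y ∈ A.erase x, (I.H x y : ℤ) = I.w i d x + d + 1
          ∨ (i = 2 ∧ d = 2 ∧ I.w i d x = 5 ∧ ∑ y ∈ A.erase x, (I.H x y : ℤ) = 9) := by omega
      rcases hu with hu | hu | ⟨rfl, rfl, hw5, hb9⟩
      · refine ⟨fun _ => 0, by simp, by simpa using hu, fun S hS hSn => ?_⟩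
        have := ht S hS hSn
        simp only [Nat.cast_zero, mul_zero, Finset.sum_const_zero]
        linarith
      · obtain ⟨y, hy, hHy⟩ : ∃ y ∈ A.erase x, I.H x y ≠ 0 := by
          by_contra hcon
          push Not at hcon
          rw [Finset.sum_eq_zero fun y hy => by rw [hcon y hy]; simp] at hu
          have := (hadm.2 {x} (by simpa using hx) (by simp)).1
          rw [pot_singleton] at this
          linarith
        refine ⟨fun z => if z = y then 1 else 0, fun z => ?_, ?_, fun S hS hSn => ?_⟩
        · dsimp only
          split_ifs with h
          · subst h; omega
          · exact Nat.zero_le _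
        · push_cast
          rw [Finset.sum_ite_eq', if_pos hy]
          linarith
        · have := ht S hS hSn
          push_cast
          rw [← Finset.mul_sum, Finset.sum_ite_eq']
          split_ifs <;> linarith
      · obtain ⟨m, m1, m2, m3⟩ := exists_two_units (W := A.erase x)
          (t := fun S => I.pot 2 2 S + 2) (H := I.H x) (fun S hS => by
            rcases S.eq_empty_or_nonempty with rfl | h
            · simp
            · exact ht S hS h)
          (fun S _ T _ => by
            have := pot_submod (I := I) (i := 2) (d := 2) (by norm_num) S T
            linarith)
          (fun S hS => by
            rcases S.eq_empty_or_nonempty with rfl | h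
            · simp
            · have hins : insert x S ⊂ A := by
                refine (Finset.insert_subset hx (hS.1.trans hW.1)).ssubset_of_ne fun e => ?_
                have : A.erase x = S := by
                  rw [← e, Finset.erase_insert fun h => hxW (hS.1 h)]
                exact hS.ne this.symm
              have h1 := two_le_pot_add hi hi2 hd hadm ih hnot hn hins (by simp)
              rw [pot_insert fun h => hxW (hS.1 h), sum_q] at h1
              have h2 := sum_R_nonneg (I := I) x S
              linarith)
          (by
            have := htx (A.erase x) le_rfl
            linarith) (by linarith)
        exact ⟨m, m1, by linarith, fun S hS _ => m3 S hS⟩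
    obtain ⟨φ, o, g2, g3⟩ := exists_coloring_with_units hadm ih hn hW (fun y _ => m y)
      (fun S hS hSn => by
        refine le_trans (le_of_eq (Finset.sum_congr rfl fun y _ => ?_)) (hmt S hS hSn)
        ring)
    have hr0 : ∀ s ∈ A.erase x, ∀ b, I.r s x b = 0 := by
      intro s hs b
      have h1 : ∑ y ∈ A.erase x, I.R x y = 0 := by exact_mod_cast ha
      have h2 := Finset.sum_eq_zero_iff.1 h1 s hs
      simp only [R, I.r_symm x s] at h2
      cases b <;> omega
    refine hnot (colorable_of_erase_of_sum_le hn hadm hx g2 m hm (fun β s hs => ?_) (by linarith))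
    rw [hr0 s hs]
    simpa using g3 s hs
  · -- one edge: its other end is to have room on both nodes
    obtain ⟨φ, o, g2, g3⟩ := exists_coloring_with_units hadm ih hn hW (fun y _ => I.R x y)
      (fun S hS hSn => by
        have h1 := ht S hS hSn
        have h2 : ∑ y ∈ S, (I.R x y : ℤ) ≤ ∑ y ∈ A.erase x, (I.R x y : ℤ) :=
          Finset.sum_le_sum_of_subset_of_nonneg hS fun _ _ _ => by positivity
        rw [Finset.sum_add_distrib]
        linarith)
    refine hnot (colorable_of_erase_of_sum_le hn hadm hx g2 (fun _ => 0) (by simp)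
      (fun β s hs => ?_) ?_)
    · have h1 := g3 s hs
      have h2 : I.r s x (φ s ^^ β) ≤ I.R x s := by
        simp only [R, I.r_symm x s]
        cases (φ s ^^ β) <;> omega
      simp only [Nat.cast_zero, add_zero]
      omega
    · rw [ha] at hQ ⊢
      simp only [Nat.cast_zero, Finset.sum_const_zero]
      linarith
  · -- at least two edges: the other ends are to have room for the rich node of `x`
    obtain ⟨φ, o, g2, g3⟩ := exists_coloring_with_units hadm ih hn hW
      (fun y β => I.r y x (β ^^ true)) (fun S hS hSn => by
        have h1 := ht S hS hSn
        have h2 := htx S hS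
        have h3 := sum_R_nonneg (I := I) x S
        have h4 := sum_H_nonneg (I := I) x S
        have h5 : ∑ y ∈ S, ((I.r y x (false ^^ true) : ℤ) + I.r y x (true ^^ true))
            = ∑ y ∈ S, (I.R x y : ℤ) := by
          refine Finset.sum_congr rfl fun y _ => ?_
          simp only [R, I.r_symm x y, Bool.xor_true, Bool.not_true, Bool.not_false]
          push_cast
          ring
        rw [h5]
        have h6 : ∑ y ∈ S, (I.R x y : ℤ) ≤ 2 ∨ 3 ≤ ∑ y ∈ S, (I.R x y : ℤ) := by omega
        rcases h6 with h6 | h6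
        · linarith
        · nlinarith)
    have hle : ∀ s, I.r s x (φ s ^^ true) ≤ I.R x s := by
      intro s
      simp only [R, I.r_symm x s]
      cases (φ s ^^ true) <;> omega
    by_cases hall : ∀ s ∈ A.erase x, I.r s x (φ s ^^ true) = I.R x s
    · refine hnot (colorable_of_erase_of_sum_le hn hadm hx g2 (fun _ => 0) (by simp)
        (fun β s hs => ?_) ?_)
      · have h1 := g3 s hs
        have h2 : I.r s x (φ s ^^ β) ≤ I.r s x (φ s ^^ true) := by
          have := hall s hs
          simp only [R, I.r_symm x s] at this
          revert this
          cases β <;> cases φ s <;> simp <;> omega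
        simp only [Nat.cast_zero, add_zero]
        omega
      · simp only [Nat.cast_zero, Finset.sum_const_zero]
        nlinarith
    · push Not at hall
      obtain ⟨s, hs, hlt⟩ := hall
      have h1 : ∑ y ∈ A.erase x, (I.r y x (φ y ^^ true) : ℤ) < ∑ y ∈ A.erase x, (I.R x y : ℤ) :=
        Finset.sum_lt_sum (fun y _ => Nat.cast_le.2 (hle y))
          ⟨s, hs, Nat.cast_lt.2 (lt_of_le_of_ne (hle s) hlt)⟩
      refine hnot (colorable_of_erase hx hn g2 true (fun _ => 0) (fun s hs => ?_) ?_)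
      · simpa using g3 s hs
      · simp only [Nat.sub_zero, Finset.sum_add_distrib]
        have h2 := sum_h_le_H (I := I) x (A.erase x) fun y => φ y ^^ true
        nlinarith

end Inst

/-! ### Orientations -/

section Orientation

variable {V : Type*} [DecidableEq V] {A : Finset V}

/-- The multigraph with `g x y` edges between `x` and `y` has an orientation in which at most `β x`
edges leave `x`, provided that every set `Z` spans at most as many edges as the sum of `β` over `Z`.
An edge `xy` cannot be oriented from `x` only if `x` and not `y` is in a set for which equality
holds. By submodularity there are no two such sets, one for each direction of the edge. -/
lemma exists_orientation {g : V → V → ℕ} {β : V → ℤ} (hs : ∀ x y, g x y = g y x)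
    (h0 : ∀ x, g x x = 0)
    (hall : ∀ Z ⊆ A, pairSum (fun x y => (g x y : ℤ)) Z ≤ ∑ x ∈ Z, β x) :
    ∃ o : V → V → ℕ, (∀ x ∈ A, ∀ y ∈ A, g x y ≤ o x y + o y x) ∧
      ∀ x ∈ A, ∑ y ∈ A, (o x y : ℤ) ≤ β x := by
  obtain ⟨N, hN⟩ : ∃ N, ∑ x ∈ A, ∑ y ∈ A, g x y ≤ N := ⟨_, le_rfl⟩
  induction N generalizing g β with
  | zero =>
    have hz : ∀ x ∈ A, ∀ y ∈ A, g x y = 0 := by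
      intro x hx y hy
      have h1 := Finset.sum_eq_zero_iff.1 (Nat.le_zero.1 hN) x hx
      exact Finset.sum_eq_zero_iff.1 h1 y hy
    refine ⟨fun _ _ => 0, fun x hx y hy => by simp [hz x hx y hy], fun x hx => ?_⟩
    have := hall {x} (by simpa using hx)
    simpa [pairSum, h0] using this
  | succ N ih =>
    by_cases hz : ∀ x ∈ A, ∀ y ∈ A, g x y = 0
    · refine ⟨fun _ _ => 0, fun x hx y hy => by simp [hz x hx y hy], fun x hx => ?_⟩
      have := hall {x} (by simpa using hx)
      simpa [pairSum, h0] using this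
    push Not at hz
    obtain ⟨x, hx, y, hy, hxy⟩ := hz
    have key : ∀ x ∈ A, ∀ y ∈ A, g x y ≠ 0 →
        (∀ Z ⊆ A, x ∈ Z → y ∉ Z → pairSum (fun x y => (g x y : ℤ)) Z < ∑ x ∈ Z, β x) →
        ∃ o : V → V → ℕ, (∀ x ∈ A, ∀ y ∈ A, g x y ≤ o x y + o y x) ∧
          ∀ x ∈ A, ∑ y ∈ A, (o x y : ℤ) ≤ β x := by
      intro x hx y hy hxy hlt
      have hne : x ≠ y := fun e => hxy (e ▸ h0 x)
      set e : V → V → ℕ := fun u v => (if u = x then if v = y then 1 else 0 else 0)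
        + (if u = y then if v = x then 1 else 0 else 0) with he
      have hes : ∀ u v, e u v = e v u := by
        intro u v
        simp only [he]
        rw [add_comm]
        simp only [← ite_and, and_comm]
      have heg : ∀ u v, e u v ≤ g u v := by
        intro u v
        by_cases h1 : u = x ∧ v = y
        · obtain ⟨rfl, rfl⟩ := h1
          simp only [he, if_true, hne, if_false]
          omega
        · by_cases h2 : u = y ∧ v = x
          · obtain ⟨rfl, rfl⟩ := h2
            simp only [he, if_true, hne.symm, if_false]
            rw [hs]
            omega
          · simp [he, ← ite_and, h1, h2]
      have hpair : ∀ Z, pairSum (fun u v => (g u v : ℤ)) Z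
          = pairSum (fun u v => ((g u v - e u v : ℕ) : ℤ)) Z + if x ∈ Z ∧ y ∈ Z then 1 else 0 := by
        intro Z
        rw [← pairSum_add_pair (fun u v => by rw [hs, hes]) (fun u => by simp [h0]) hne]
        congr 1
        funext u v
        rw [Nat.cast_sub (heg u v)]
        simp only [he]
        push_cast
        ring
      have hsum1 : ∀ f : V → ℤ, ∀ Z : Finset V, ∑ u ∈ Z, (f u - if u = x then 1 else 0)
          = ∑ u ∈ Z, f u - if x ∈ Z then 1 else 0 := by
        intro f Z
        rw [Finset.sum_sub_distrib, Finset.sum_ite_eq']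
      obtain ⟨o, o1, o2⟩ := ih (g := fun u v => g u v - e u v)
        (β := fun u => β u - if u = x then 1 else 0)
        (fun u v => by rw [hs, hes]) (fun u => by simp [h0]) (fun Z hZ => by
          have h1 := hall Z hZ
          rw [hpair] at h1
          rw [hsum1]
          by_cases hxZ : x ∈ Z <;> by_cases hyZ : y ∈ Z
          · simp only [hxZ, hyZ, and_self, if_true] at h1 ⊢
            linarith
          · have h2 := hlt Z hZ hxZ hyZ
            rw [hpair] at h2
            simp only [hxZ, hyZ, and_false, if_false, if_true] at h2 ⊢
            linarith
          · simpa [hxZ] using h1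
          · simpa [hxZ] using h1)
        (by
          have h1 : ∑ u ∈ A, ∑ v ∈ A, (g u v - e u v) < ∑ u ∈ A, ∑ v ∈ A, g u v := by
            refine Finset.sum_lt_sum (fun u _ => Finset.sum_le_sum fun v _ => Nat.sub_le _ _)
              ⟨x, hx, Finset.sum_lt_sum (fun v _ => Nat.sub_le _ _) ⟨y, hy, ?_⟩⟩
            have : e x y = 1 := by simp [he, hne]
            omega
          omega)
      refine ⟨fun u v => o u v + if u = x then if v = y then 1 else 0 else 0,
        fun u hu v hv => ?_, fun u hu => ?_⟩
      · have h1 := o1 u hu v hv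
        have h2 : e u v = (if u = x then if v = y then 1 else 0 else 0)
          + (if v = x then if u = y then 1 else 0 else 0) := by
          simp only [he]
          congr 1
          simp only [← ite_and, and_comm]
        dsimp only at h1 ⊢
        omega
      · have h1 := o2 u hu
        push_cast
        rw [Finset.sum_add_distrib]
        have h2 : ∑ v ∈ A, (if u = x then if v = y then (1 : ℤ) else 0 else 0)
            = if u = x then 1 else 0 := by
          split_ifs <;> simp [hy]
        rw [h2]
        linarith
    by_cases hZ1 : ∀ Z ⊆ A, x ∈ Z → y ∉ Z → pairSum (fun x y => (g x y : ℤ)) Z < ∑ x ∈ Z, β x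
    · exact key x hx y hy hxy hZ1
    · refine key y hy x hx (by rwa [hs]) fun T hT hyT hxT => ?_
      push Not at hZ1
      obtain ⟨Z, hZ, hxZ, hyZ, hle⟩ := hZ1
      have h1 := pairSum_add_le (q := fun x y => (g x y : ℤ)) (fun u v => by rw [hs])
        (fun u => by simp [h0]) Z T
      have h2 : (1 : ℤ) ≤ ∑ u ∈ Z \ T, ∑ v ∈ T \ Z, (g u v : ℤ) := by
        have a1 : (g x y : ℤ) ≤ ∑ v ∈ T \ Z, (g x v : ℤ) :=
          Finset.single_le_sum (f := fun v => (g x v : ℤ)) (fun v _ => by positivity)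
            (by simp [hyT, hyZ])
        have a2 : ∑ v ∈ T \ Z, (g x v : ℤ) ≤ ∑ u ∈ Z \ T, ∑ v ∈ T \ Z, (g u v : ℤ) :=
          Finset.single_le_sum (f := fun u => ∑ v ∈ T \ Z, (g u v : ℤ))
            (fun u _ => Finset.sum_nonneg fun v _ => by positivity) (by simp [hxZ, hxT])
        have a3 : (1 : ℤ) ≤ g x y := by omega
        linarith
      have h3 := hall (Z ∪ T) (Finset.union_subset hZ hT)
      have h4 := hall (Z ∩ T) (Finset.inter_subset_left.trans hZ)
      have h5 : ∑ x ∈ Z ∪ T, β x + ∑ x ∈ Z ∩ T, β x = ∑ x ∈ Z, β x + ∑ x ∈ T, β x :=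
        Finset.sum_union_inter
      linarith

end Orientation

/-! ### Locally optimal choices of nodes -/

section LocallyOptimal

variable {V : Type*} [DecidableEq V]

/-- A choice of nodes that minimises the total active weight minus twice the capacities: switching the
node of one vertex does not help. -/
lemma exists_locally_optimal (A : Finset V) (f : V → V → Bool → ℤ) (c : V → Bool → ℤ)
    (hs : ∀ x y b, f x y b = f y x b) (h0 : ∀ x b, f x x b = 0) :
    ∃ φ : V → Bool, ∀ v ∈ A, 2 * ∑ y ∈ A, f v y (φ v ^^ φ y)
      ≤ ∑ y ∈ A, (f v y false + f v y true) + 2 * c v (φ v) - 2 * c v (!(φ v)) := by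
  classical
  -- choices are represented by the sets of vertices with rich node
  set F : (V → Bool) → ℤ := fun φ => pairSum (fun x y => f x y (φ x ^^ φ y)) A
    - 2 * ∑ x ∈ A, c x (φ x) with hF
  obtain ⟨T, -, hT⟩ := Finset.exists_min_image A.powerset
    (fun T => F fun x => decide (x ∈ T)) ⟨∅, by simp⟩
  have hmin : ∀ ψ : V → Bool, F (fun x => decide (x ∈ T)) ≤ F ψ := by
    intro ψ
    have h1 := hT (A.filter fun x => ψ x = true) (by simp)
    refine h1.trans (le_of_eq ?_)
    have h2 : ∀ x ∈ A, decide (x ∈ A.filter fun x => ψ x = true) = ψ x := by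
      intro x hx; simp [hx]
    have h3 : pairSum (fun x y => f x y (decide (x ∈ A.filter fun x => ψ x = true) ^^
        decide (y ∈ A.filter fun x => ψ x = true))) A = pairSum (fun x y => f x y (ψ x ^^ ψ y)) A := by
      unfold pairSum
      congr 1
      exact Finset.sum_congr rfl fun x hx => Finset.sum_congr rfl fun y hy => by
        dsimp only
        rw [h2 x hx, h2 y hy]
    have h4 : ∑ x ∈ A, c x (decide (x ∈ A.filter fun x => ψ x = true)) = ∑ x ∈ A, c x (ψ x) :=
      Finset.sum_congr rfl fun x hx => by rw [h2 x hx]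
    simp only [hF]
    rw [h3, h4]
  set φ : V → Bool := fun x => decide (x ∈ T) with hφ
  refine ⟨φ, fun v hv => ?_⟩
  have h1 := hmin (Function.update φ v !(φ v))
  have hps : ∀ ψ : V → Bool, F ψ = pairSum (fun x y => f x y (ψ x ^^ ψ y)) (A.erase v)
      + ∑ y ∈ A.erase v, f v y (ψ v ^^ ψ y) - 2 * (∑ x ∈ A.erase v, c x (ψ x) + c v (ψ v)) := by
    intro ψ
    have := pairSum_insert (q := fun x y => f x y (ψ x ^^ ψ y))
      (fun x y => by rw [hs, Bool.xor_comm]) (fun x => h0 x _) (Finset.notMem_erase v A)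
    rw [Finset.insert_erase hv] at this
    simp only [hF]
    rw [this, Finset.sum_erase_add _ _ hv]
  have hne : ∀ x ∈ A.erase v, Function.update φ v (!(φ v)) x = φ x := fun x hx =>
    Function.update_of_ne (Finset.ne_of_mem_erase hx) _ _
  rw [hps, hps] at h1
  have e1 : pairSum (fun x y => f x y (Function.update φ v (!(φ v)) x
      ^^ Function.update φ v (!(φ v)) y)) (A.erase v)
      = pairSum (fun x y => f x y (φ x ^^ φ y)) (A.erase v) := by
    unfold pairSum
    congr 1
    exact Finset.sum_congr rfl fun x hx => Finset.sum_congr rfl fun y hy => by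
      dsimp only
      rw [hne x hx, hne y hy]
  have e2 : ∑ x ∈ A.erase v, c x (Function.update φ v (!(φ v)) x) = ∑ x ∈ A.erase v, c x (φ x) :=
    Finset.sum_congr rfl fun x hx => by rw [hne x hx]
  have e3 : ∑ y ∈ A.erase v, f v y (Function.update φ v (!(φ v)) v
      ^^ Function.update φ v (!(φ v)) y)
      = ∑ y ∈ A.erase v, (f v y false + f v y true) - ∑ y ∈ A.erase v, f v y (φ v ^^ φ y) := by
    rw [← Finset.sum_sub_distrib]
    refine Finset.sum_congr rfl fun y hy => ?_
    rw [hne y hy, Function.update_self]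
    cases φ v <;> cases φ y <;> simp
  rw [e1, e2, e3, Function.update_self] at h1
  have e4 : ∑ y ∈ A, f v y (φ v ^^ φ y) = ∑ y ∈ A.erase v, f v y (φ v ^^ φ y) := by
    rw [← Finset.sum_erase_add _ _ hv, h0, add_zero]
  have e5 : ∑ y ∈ A, (f v y false + f v y true) = ∑ y ∈ A.erase v, (f v y false + f v y true) := by
    rw [← Finset.sum_erase_add _ _ hv, h0, h0, add_zero, add_zero]
  rw [e4, e5]
  linarith

end LocallyOptimal

/-! ### Colouring admissible instances -/

namespace Inst

variable {V : Type*} [DecidableEq V] {I : Inst V} {i d : ℤ} {A : Finset V}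

/-- An instance in which every vertex meets edges of total weight at least twice its own is
colourable: the excesses sum to at most `2 * d`, so a locally optimal choice of nodes meets the
capacities up to one half at a single vertex, which does not matter to the orientation. -/
lemma colorable_of_two_mul_w_le (hi : 1 ≤ i) (hd : 1 ≤ d) (hadm : I.Adm i d A)
    (hn : ∀ x ∈ A, I.n x = 0)
    (hw : ∀ x ∈ A, 2 * I.w i d x ≤ ∑ y ∈ A.erase x, I.q i x y) : I.Colorable A := by
  rcases A.eq_empty_or_nonempty with rfl | hA
  · exact ⟨fun _ => false, fun _ _ => 0, by simp, by simp, by simp⟩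
  have herase : ∀ x ∈ A, ∑ y ∈ A.erase x, I.q i x y = ∑ y ∈ A, I.q i x y := fun x hx => by
    rw [← Finset.sum_erase_add _ _ hx, q_self, add_zero]
  have htot : ∑ x ∈ A, (∑ y ∈ A, I.q i x y - 2 * I.w i d x) ≤ 2 * d := by
    have h1 := (hadm.2 A le_rfl hA).1
    have h2 := two_mul_pairSum (q := I.q i) q_symm q_self A
    rw [pot] at h1
    rw [Finset.sum_sub_distrib, ← h2, ← Finset.mul_sum]
    linarith
  have hex0 : ∀ x ∈ A, 0 ≤ ∑ y ∈ A, I.q i x y - 2 * I.w i d x := fun x hx => by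
    have := hw x hx
    rw [herase x hx] at this
    linarith
  obtain ⟨φ, hφ⟩ := exists_locally_optimal A (fun x y b => 2 * (I.r x y b : ℤ) + I.h x y b) I.c
    (fun x y b => by rw [I.r_symm, I.h_symm]) (fun x b => by simp [I.r_self, I.h_self])
  have hW : ∀ x, ∑ y ∈ A, ((2 * (I.r x y false : ℤ) + I.h x y false)
      + (2 * (I.r x y true : ℤ) + I.h x y true)) ≤ ∑ y ∈ A, I.q i x y := by
    intro x
    refine Finset.sum_le_sum fun y _ => ?_
    simp only [q, R, H]
    push_cast
    have : (0 : ℤ) ≤ (I.r x y false : ℤ) + I.r x y true := by positivity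
    nlinarith
  set ra : V → ℤ := fun x => ∑ y ∈ A, (I.r x y (φ x ^^ φ y) : ℤ) with hra
  set ha : V → ℤ := fun x => ∑ y ∈ A, (I.h x y (φ x ^^ φ y) : ℤ) with hha
  have hact : ∀ x ∈ A, 2 * (2 * ra x + ha x)
      ≤ 4 * I.c x (φ x) + 2 - 2 * d + (∑ y ∈ A, I.q i x y - 2 * I.w i d x) := by
    intro x hx
    have h1 := hφ x hx
    have h2 := hW x
    have h3 := (w_le hadm hn hx).1
    have h4 : ∑ y ∈ A, (2 * (I.r x y (φ x ^^ φ y) : ℤ) + I.h x y (φ x ^^ φ y))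
        = 2 * ra x + ha x := by
      rw [Finset.sum_add_distrib, ← Finset.mul_sum]
    rw [h4] at h1
    have h5 : I.c x false + I.c x true = I.c x (φ x) + I.c x (!(φ x)) := by
      cases φ x <;> simp [add_comm]
    linarith
  -- at most one vertex attains the maximal excess
  have hsmall : ∀ Z ⊆ A, ∑ x ∈ Z, ha x ≤ ∑ x ∈ Z, 2 * (I.c x (φ x) - ra x) + 1 := by
    intro Z hZ
    by_cases hex : ∃ v ∈ Z, ∑ y ∈ A, I.q i v y - 2 * I.w i d v = 2 * d
    · obtain ⟨v, hv, hv2⟩ := hex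
      have hzero : ∀ x ∈ A.erase v, ∑ y ∈ A, I.q i x y - 2 * I.w i d x ≤ 0 := by
        intro x hx
        rw [← Finset.sum_erase_add _ _ (hZ hv), hv2] at htot
        have := Finset.single_le_sum (f := fun x => ∑ y ∈ A, I.q i x y - 2 * I.w i d x)
          (fun x hx => hex0 x (Finset.erase_subset v A hx)) hx
        linarith
      rw [← Finset.sum_erase_add _ _ hv,
        ← Finset.sum_erase_add Z (fun x => 2 * (I.c x (φ x) - ra x)) hv]
      have h1 : ∑ x ∈ Z.erase v, ha x ≤ ∑ x ∈ Z.erase v, 2 * (I.c x (φ x) - ra x) := by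
        refine Finset.sum_le_sum fun x hx => ?_
        have hxA : x ∈ A := hZ (Finset.erase_subset v Z hx)
        have := hact x hxA
        have := hzero x (Finset.erase_subset_erase v hZ hx)
        omega
      have := hact v (hZ hv)
      omega
    · push Not at hex
      have h1 : ∑ x ∈ Z, ha x ≤ ∑ x ∈ Z, 2 * (I.c x (φ x) - ra x) := by
        refine Finset.sum_le_sum fun x hx => ?_
        have h1 := hact x (hZ hx)
        have h2 := Finset.single_le_sum (f := fun x => ∑ y ∈ A, I.q i x y - 2 * I.w i d x)
          hex0 (hZ hx)
        have h3 := hex x hx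
        omega
      linarith
  obtain ⟨o, o1, o2⟩ := exists_orientation (A := A) (g := fun x y => I.h x y (φ x ^^ φ y))
    (β := fun x => I.c x (φ x) - ra x) (fun x y => by rw [I.h_symm, Bool.xor_comm])
    (fun x => I.h_self x _) (fun Z hZ => by
      have h1 := hsmall Z hZ
      have h2 := two_mul_pairSum (q := fun x y => (I.h x y (φ x ^^ φ y) : ℤ))
        (fun x y => by rw [I.h_symm, Bool.xor_comm]) (fun x => by rw [I.h_self]; rfl) Z
      have h3 : ∑ x ∈ Z, ∑ y ∈ Z, (I.h x y (φ x ^^ φ y) : ℤ) ≤ ∑ x ∈ Z, ha x :=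
        Finset.sum_le_sum fun x _ =>
          Finset.sum_le_sum_of_subset_of_nonneg hZ fun _ _ _ => by positivity
      rw [← Finset.mul_sum] at h1
      omega)
  refine ⟨φ, o, fun x hx _ => hn x hx, o1, fun x hx => ?_⟩
  have := o2 x hx
  rw [Finset.sum_add_distrib]
  linarith

theorem colorable_of_adm (hi : 1 ≤ i) (hi2 : i ≤ 2) (hd : i ≤ d) (hadm : I.Adm i d A) :
    I.Colorable A := by
  obtain ⟨k, hk⟩ : ∃ k, A.card = k := ⟨_, rfl⟩
  induction k using Nat.strong_induction_on generalizing I A with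
  | _ k ih =>
    subst hk
    have ih' : ColorableBelow V i d A.card := fun J B hB hJ => ih _ hB hJ rfl
    by_contra hnot
    have hn : ∀ x ∈ A, I.n x = 0 := fun x hx =>
      n_eq_zero_of_not_colorable hi hi2 (by linarith) hadm ih' hnot hx
    exact hnot (colorable_of_two_mul_w_le hi (by linarith) hadm hn fun x hx =>
      two_mul_w_le hi hi2 hd hadm ih' hnot hn hx)

end Inst

/-! ### Instances from covers -/

open Classical in
lemma two_mul_ncard_edgeSet_induce {V : Type*} [Fintype V] (G : SimpleGraph V) (S : Finset V) :
    2 * ((⊤ : G.Subgraph).induce (S : Set V)).edgeSet.ncard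
      = ∑ x ∈ S, ∑ y ∈ S, if G.Adj x y then 1 else 0 := by
  set K := ((⊤ : G.Subgraph).induce (S : Set V)).spanningCoe with hK
  have hadj : ∀ x y, K.Adj x y ↔ x ∈ S ∧ y ∈ S ∧ G.Adj x y := by
    intro x y
    simp [hK]
  have h1 := K.sum_degrees_eq_twice_card_edges
  have h2 : ((⊤ : G.Subgraph).induce (S : Set V)).edgeSet.ncard = K.edgeFinset.card := by
    rw [← Set.ncard_coe_finset, SimpleGraph.coe_edgeFinset, hK,
      SimpleGraph.Subgraph.edgeSet_spanningCoe]
  rw [h2, ← h1]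
  have h3 : ∀ x, K.degree x = if x ∈ S then ∑ y ∈ S, (if G.Adj x y then 1 else 0) else 0 := by
    intro x
    rw [← SimpleGraph.card_neighborFinset_eq_degree, ← Finset.card_filter]
    split_ifs with hx
    · congr 1
      ext y
      simp [hadj, hx]
    · rw [Finset.card_eq_zero]
      ext y
      simp [hadj, hx]
  rw [Finset.sum_congr rfl fun x _ => h3 x, Finset.sum_ite_mem, Finset.univ_inter]

section Cover

variable {V : Type u} {G : SimpleGraph V} {W : Type u} (C : DPCover G W) (p r : V → W)

open Classical in
/-- The instance of a cover with capacities `i` and `j`. The edges over `xy` go into one class, that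
of the pairs of nodes of equal kind or that of the pairs of different kinds, since they form a
matching. -/
noncomputable def ofCover (i j : ℤ) : Inst V where
  c _ β := bif β then j else i
  n _ := 0
  r x y b := if G.Adj x y ∧ (b = false ↔ C.graph.Adj (p x) (p y) ∨ C.graph.Adj (r x) (r y))
    then 1 else 0
  h _ _ _ := 0
  r_symm x y b := by
    simp only [G.adj_comm x y, C.graph.adj_comm (p x), C.graph.adj_comm (r x)]
  h_symm _ _ _ := rfl
  r_self x b := by simp
  h_self _ _ := rfl
  r_le x y := by
    by_cases h : C.graph.Adj (p x) (p y) ∨ C.graph.Adj (r x) (r y) <;> simp [h] <;> split_ifs <;>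
      omega

variable {C p r} {i j : ℤ}

open Classical in
lemma ofCover_R (x y : V) : (ofCover C p r i j).R x y = if G.Adj x y then 1 else 0 := by
  by_cases h : C.graph.Adj (p x) (p y) ∨ C.graph.Adj (r x) (r y) <;>
    by_cases h' : G.Adj x y <;> simp [Inst.R, ofCover, h, h']

lemma ofCover_w (x : V) : (ofCover C p r i j).w i (j - i) x = 2 * i + 1 := by
  simp only [Inst.w, ofCover, cond_false, cond_true]
  push_cast
  ring

lemma ofCover_r_of_adj (hL : ∀ v, C.L v = {p v, r v}) (hne : ∀ v, p v ≠ r v) {x y : V}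
    (hxy : x ≠ y) {α β : Bool}
    (h : C.graph.Adj (bif α then r x else p x) (bif β then r y else p y)) :
    (ofCover C p r i j).r x y (α ^^ β) = 1 := by
  have hp : ∀ v, p v ∈ C.L v := fun v => by simp [hL]
  have hr : ∀ v, r v ∈ C.L v := fun v => by simp [hL]
  have hmem : ∀ v (α : Bool), (bif α then r v else p v) ∈ C.L v := fun v α => by
    cases α
    · exact hp v
    · exact hr v
  have hG : G.Adj x y := (C.edge x y _ (hmem x α) _ (hmem y β) h).resolve_left hxy
  have hm := C.matching x y hG
  have hm' := C.matching y x hG.symm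
  simp only [ofCover]
  rw [if_pos]
  refine ⟨hG, ?_⟩
  cases α <;> cases β <;> simp only [cond_true, cond_false] at h
  · simp [h]
  · simp only [Bool.false_xor, Bool.true_eq_false, false_iff, not_or]
    exact ⟨fun h' => hne y (hm _ (hp x) _ (hp y) _ (hr y) h' h),
      fun h' => hne x (hm' _ (hr y) _ (hp x) _ (hr x) h.symm h'.symm)⟩
  · simp only [Bool.xor_false, Bool.true_eq_false, false_iff, not_or]
    exact ⟨fun h' => hne x (hm' _ (hp y) _ (hp x) _ (hr x) h'.symm h.symm),
      fun h' => hne y (hm _ (hr x) _ (hp y) _ (hr y) h h')⟩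
  · simp [h]

lemma exists_isDefectiveColoring [Fintype V] [DecidableEq V] {i j : ℕ} (hC : C.IsFold 2)
    (hL : ∀ v, C.L v = {p v, r v})
    (h : (ofCover C p r i j).Colorable Finset.univ) : ∃ φ, C.IsDefectiveColoring p r i j φ := by
  classical
  have hne : ∀ v, p v ≠ r v := by
    intro v e
    have h1 := hC v
    rw [hL, e] at h1
    simp at h1
  obtain ⟨ψ, o, -, -, h3⟩ := h
  set node : V → Bool → W := fun v α => bif α then r v else p v with hnode
  have hmem : ∀ v α, node v α ∈ C.L v := fun v α => by
    rw [hL]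
    cases α <;> simp [hnode]
  have hinj : ∀ u v α β, node u α = node v β → u = v ∧ α = β := by
    intro u v α β e
    have huv : u = v := (C.partition (node u α)).unique (hmem u α) (e ▸ hmem v β)
    subst huv
    refine ⟨rfl, ?_⟩
    revert e
    cases α <;> cases β <;> simp [hnode, hne u, (hne u).symm]
  have hdeg : ∀ v α (hv : node v α ∈ Set.range fun v => node v (ψ v)),
      ((C.inducedCoverGraph fun v => node v (ψ v)).neighborSet ⟨node v α, hv⟩).encard
        ≤ (bif α then j else i : ℕ) := by
    intro v α hv
    have hα : ψ v = α := by
      obtain ⟨u, hu⟩ := hv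
      obtain ⟨rfl, e⟩ := hinj _ _ _ _ hu
      exact e
    set T : Finset V := Finset.univ.filter fun y => (ofCover C p r i j).r v y (ψ v ^^ ψ y) = 1
    have hT : T.card ≤ (bif α then j else i : ℕ) := by
      have h1 := h3 v (Finset.mem_univ v)
      have h2 : (T.card : ℤ) ≤ ∑ y, (((ofCover C p r i j).r v y (ψ v ^^ ψ y) : ℤ) + o v y) := by
        rw [Finset.card_filter]
        push_cast
        refine Finset.sum_le_sum fun y _ => ?_
        split_ifs with hy
        · rw [hy]; push_cast; linarith [Nat.cast_nonneg (α := ℤ) (o v y)]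
        · positivity
      have h4 : (ofCover C p r i j).c v (ψ v) = ((bif α then j else i : ℕ) : ℤ) := by
        rw [hα]
        cases α <;> rfl
      exact_mod_cast (h4 ▸ h2.trans h1)
    have hsub : (C.inducedCoverGraph fun v => node v (ψ v)).neighborSet ⟨node v α, hv⟩
        ⊆ (fun y => (⟨node y (ψ y), y, rfl⟩ : Set.range fun v => node v (ψ v))) '' (T : Set V) := by
      rintro ⟨_, y, rfl⟩ hy
      refine ⟨y, ?_, rfl⟩
      have hadj : C.graph.Adj (node v α) (node y (ψ y)) := hy
      have hvy : v ≠ y := by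
        rintro rfl
        rw [hα] at hadj
        exact hadj.ne rfl
      rw [← hα] at hadj
      simpa [T] using ofCover_r_of_adj hL hne hvy hadj
    refine (Set.encard_le_encard hsub).trans ((Set.encard_image_le _ _).trans ?_)
    rw [Set.encard_coe_eq_coe_finsetCard]
    exact_mod_cast hT
  exact ⟨fun v => node v (ψ v), ⟨fun u v e => (hinj _ _ _ _ e).1, fun v => hmem v _⟩,
    fun v hv => hdeg v false hv, fun v hv => hdeg v true hv⟩

end Cover

theorem isDefectiveDPColorable_of_sparse {V : Type u} [Finite V] {G : SimpleGraph V} {i j : ℕ}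
    (hi : i = 1 ∨ i = 2) (hj : 2 * i ≤ j)
    (hG : ∀ H : G.Subgraph,
      (H.edgeSet.ncard : ℚ) ≤ ((2 * i + 1) * H.verts.ncard + j - i) / (i + 1)) :
    IsDefectiveDPColorable G i j := by
  classical
  have := Fintype.ofFinite V
  intro W C hC p r hL
  refine exists_isDefectiveColoring hC hL (Inst.colorable_of_adm (i := i) (d := j - i)
    (by omega) (by omega) (by omega) ⟨fun x _ => ?_, fun S _ _ => ⟨?_, ?_⟩⟩)
  · simp [ofCover]
  · have h1 := hG ((⊤ : G.Subgraph).induce (S : Set V))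
    have h2 := two_mul_ncard_edgeSet_induce G S
    have h3 := two_mul_pairSum (q := (ofCover C p r i j).q i) Inst.q_symm Inst.q_self S
    have h4 : ∑ x ∈ S, ∑ y ∈ S, (ofCover C p r i j).q i x y
        = (i + 1) * ((∑ x ∈ S, ∑ y ∈ S, if G.Adj x y then 1 else 0 : ℕ) : ℤ) := by
      push_cast
      rw [Finset.mul_sum]
      refine Finset.sum_congr rfl fun x _ => ?_
      rw [Finset.mul_sum]
      refine Finset.sum_congr rfl fun y _ => ?_
      rw [Inst.q, ofCover_R]
      simp [Inst.H, ofCover]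
    rw [h4, ← h2] at h3
    rw [le_div_iff₀ (by positivity)] at h1
    have h5 : (((⊤ : G.Subgraph).induce (S : Set V)).verts.ncard : ℚ) = S.card := by
      simp [Set.ncard_coe_finset]
    rw [h5] at h1
    have h6 : (((⊤ : G.Subgraph).induce (S : Set V)).edgeSet.ncard : ℤ) * (i + 1)
        ≤ (2 * i + 1) * S.card + j - i := by exact_mod_cast h1
    rw [Inst.pot, Finset.sum_congr rfl fun x _ => ofCover_w x, Finset.sum_const, nsmul_eq_mul]
    push_cast at h3
    linarith
  · rintro ⟨x, -, hx⟩
    exact absurd rfl hx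

/-! ### Graphs with signed edges -/

section Signed

variable {N : Type u} {E : Type*} (a b : E → N) (σ : E → Bool)

/-- The graph with an edge between `a e` and `b e` for every `e`. -/
def graphOf : SimpleGraph N := SimpleGraph.fromEdgeSet (Set.range fun e => s(a e, b e))

variable {a b}

lemma graphOf_edgeSet (hne : ∀ e, a e ≠ b e) :
    (graphOf a b).edgeSet = Set.range fun e => s(a e, b e) := by
  rw [graphOf, SimpleGraph.edgeSet_fromEdgeSet, sdiff_eq_left, Set.disjoint_left]
  rintro _ ⟨e, rfl⟩ h
  exact hne e (by simpa using h)

lemma graphOf_adj (hne : ∀ e, a e ≠ b e) {u v : N} :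
    (graphOf a b).Adj u v ↔ ∃ e, s(a e, b e) = s(u, v) := by
  rw [← SimpleGraph.mem_edgeSet, graphOf_edgeSet hne]
  rfl

variable (a b) in
/-- The cover of `graphOf a b` with nodes `(v, false)` and `(v, true)` over `v`, in which the edge
`e` joins the nodes whose second components differ by `σ e`. -/
def signedCover (hne : ∀ e, a e ≠ b e) (hinj : Function.Injective fun e => s(a e, b e)) :
    DPCover (graphOf a b) (N × Bool) where
  graph :=
    { Adj x y := (x.1 = y.1 ∧ x.2 ≠ y.2) ∨ ∃ e, s(a e, b e) = s(x.1, y.1) ∧ σ e = (x.2 ^^ y.2)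
      symm := ⟨by
        rintro x y (h | ⟨e, h1, h2⟩)
        · exact Or.inl ⟨h.1.symm, h.2.symm⟩
        · exact Or.inr ⟨e, by rw [h1, Sym2.eq_swap], by rw [h2, Bool.xor_comm]⟩⟩
      loopless := ⟨by
        rintro x (h | ⟨e, h1, -⟩)
        · exact h.2 rfl
        · refine hne e ?_
          rw [Sym2.eq_iff] at h1
          rcases h1 with h | h <;> rw [h.1, h.2]⟩ }
  L v := {(v, false), (v, true)}
  partition := by
    rintro ⟨v, α⟩
    refine ⟨v, by cases α <;> simp, fun w hw => ?_⟩
    rcases hw with h | h <;> exact (congrArg Prod.fst h).symm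
  complete := by
    intro v x hx y hy hxy
    left
    rcases hx with rfl | rfl <;> rcases hy with rfl | rfl <;> simp at hxy ⊢
  edge := by
    intro v w x hx y hy h
    have hx1 : x.1 = v := by rcases hx with rfl | rfl <;> rfl
    have hy1 : y.1 = w := by rcases hy with rfl | rfl <;> rfl
    rcases h with h | ⟨e, h1, -⟩
    · exact Or.inl (by rw [← hx1, ← hy1, h.1])
    · exact Or.inr ((graphOf_adj hne).2 ⟨e, by rw [h1, hx1, hy1]⟩)
  matching := by
    intro v w hvw x hx y hy z hz hxy hxz
    have hx1 : x.1 = v := by rcases hx with rfl | rfl <;> rfl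
    have hy1 : y.1 = w := by rcases hy with rfl | rfl <;> rfl
    have hz1 : z.1 = w := by rcases hz with rfl | rfl <;> rfl
    rcases hxy with h | ⟨e, h1, h2⟩
    · exact absurd (hx1.symm.trans (h.1.trans hy1)) hvw.ne
    rcases hxz with h | ⟨e', h1', h2'⟩
    · exact absurd (hx1.symm.trans (h.1.trans hz1)) hvw.ne
    have hee : e = e' := hinj (by dsimp only; rw [h1, h1', hy1, hz1])
    subst hee
    refine Prod.ext (hy1.trans hz1.symm) ?_
    rw [h2] at h2'
    simpa using h2'

/-- A defective colouring of `signedCover` as a choice `φ` of signs: at every vertex the number of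
conflicting edges, counted by an injective family `f` of them, is at most the capacity. -/
lemma exists_card_le_of_isDefectiveDPColorable (hne : ∀ e, a e ≠ b e)
    (hinj : Function.Injective fun e => s(a e, b e)) {i j : ℕ}
    (h : IsDefectiveDPColorable (graphOf a b) i j) :
    ∃ φ : N → Bool, ∀ (v : N) (ι : Type) [Fintype ι] (f : ι → E), Function.Injective f →
      (∀ k, (a (f k) = v ∨ b (f k) = v) ∧ σ (f k) = (φ (a (f k)) ^^ φ (b (f k)))) →
      Fintype.card ι ≤ bif φ v then j else i := by
  classical
  set C := signedCover a b σ hne hinj with hC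
  obtain ⟨ψ, ⟨-, h2⟩, h3, h4⟩ := h (N × Bool) C (fun v => by
    change ({(v, false), (v, true)} : Set (N × Bool)).encard = _
    rw [Set.encard_pair (by simp)]
    rfl) (fun v => (v, false)) (fun v => (v, true)) (fun v => rfl)
  have hψ : ∀ v, ψ v = (v, (ψ v).2) := fun v => by
    rcases h2 v with h | h <;> rw [h]
  refine ⟨fun v => (ψ v).2, fun v ι _ f hf hfv => ?_⟩
  have hmem : ψ v ∈ Set.range ψ := ⟨v, rfl⟩
  have hdeg : ((C.inducedCoverGraph ψ).neighborSet ⟨ψ v, hmem⟩).encard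
      ≤ ((bif (ψ v).2 then j else i : ℕ) : ℕ∞) := by
    rcases hα : (ψ v).2 with _ | _
    · have e : ψ v = (v, false) := by rw [hψ, hα]
      have := h3 v (show (v, false) ∈ _ from e ▸ hmem)
      simpa only [e, cond_false, cond_true] using this
    · have e : ψ v = (v, true) := by rw [hψ, hα]
      have := h4 v (show (v, true) ∈ _ from e ▸ hmem)
      simpa only [e, cond_false, cond_true] using this
  -- the other end of an edge at `v`
  set g : ι → N := fun k => if a (f k) = v then b (f k) else a (f k) with hg
  have hgv : ∀ k, s(a (f k), b (f k)) = s(v, g k) := by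
    intro k
    by_cases h : a (f k) = v
    · simp only [hg, h, if_true]
    · have := (hfv k).1.resolve_left h
      simp only [hg, h, if_false]
      rw [this, Sym2.eq_swap]
  have hginj : Function.Injective g := by
    intro k l hkl
    refine hf (hinj ?_)
    dsimp only
    rw [hgv, hgv, hkl]
  have hsub : (Set.range fun k => Set.rangeFactorization ψ (g k))
      ⊆ (C.inducedCoverGraph ψ).neighborSet ⟨ψ v, hmem⟩ := by
    rintro _ ⟨k, rfl⟩
    change C.graph.Adj (ψ v) (ψ (g k))
    right
    refine ⟨f k, ?_, ?_⟩
    · rw [hψ v, hψ (g k)]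
      exact hgv k
    · rw [(hfv k).2]
      rcases Sym2.eq_iff.1 (hgv k) with h | h
      · rw [h.1, h.2]
      · rw [h.1, h.2, Bool.xor_comm]
  have hcard : (Fintype.card ι : ℕ∞)
      ≤ (Set.range fun k => Set.rangeFactorization ψ (g k)).encard := by
    rw [← ENat.card_eq_coe_fintype_card]
    refine Function.Injective.encard_range fun k l hkl => ?_
    have h1 : ψ (g k) = ψ (g l) := congrArg Subtype.val hkl
    rw [hψ, hψ (g l)] at h1
    exact hginj (congrArg Prod.fst h1)
  exact_mod_cast hcard.trans ((Set.encard_le_encard hsub).trans hdeg)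

end Signed

/-! ### The gadgets -/

namespace Gadget

/-- The leaves of a gadget: `i` of them at every vertex of the path, and one more at its last
vertex. -/
abbrev Leaf (i m : ℕ) := Fin (m + 1) × Fin i ⊕ Unit

/-- The index set of the gadgets. -/
abbrev Kind (i j : ℕ) := Fin (j + 1) ⊕ Fin (i + 1)

/-- The vertices of the graph: a centre `none`, and in every gadget the `m + 1` vertices of a path
and the leaves. -/
abbrev Vtx (i j m : ℕ) := Option (Kind i j × (Fin (m + 1) ⊕ Leaf i m))

/-- The edges of the graph: in every gadget one edge joins the centre to the first vertex of the
path, `m` edges form the path, and every leaf is joined to the centre and to its vertex of the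
path. -/
abbrev Edge (i j m : ℕ) := Kind i j × (Option (Fin m) ⊕ Leaf i m × Bool)

/-- The vertex of the path to which a leaf is joined. -/
def base {i m : ℕ} : Leaf i m → Fin (m + 1) := Sum.elim Prod.fst fun _ => Fin.last m

variable {i j m : ℕ}

/-- The end of an edge that is farther from the centre. -/
def src : Edge i j m → Vtx i j m
  | (k, .inl none) => some (k, .inl 0)
  | (k, .inl (some s)) => some (k, .inl s.succ)
  | (k, .inr (e, _)) => some (k, .inr e)

/-- The end of an edge that is closer to the centre. -/
def tgt : Edge i j m → Vtx i j m
  | (_, .inl none) => none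
  | (k, .inl (some s)) => some (k, .inl s.castSucc)
  | (_, .inr (_, false)) => none
  | (k, .inr (e, true)) => some (k, .inl (base e))

/-- The sign of an edge: the gadgets of the first kind are joined to the centre by edges between
nodes of equal kind, those of the second kind by edges between nodes of different kinds. -/
def sgn : Edge i j m → Bool
  | (k, .inl none) => k.isRight
  | (_, .inl (some _)) => true
  | (k, .inr (_, false)) => k.isRight
  | (_, .inr (_, true)) => false

lemma src_ne_tgt (e : Edge i j m) : src e ≠ tgt e := by
  rcases e with ⟨k, (_ | s) | ⟨e, _ | _⟩⟩ <;> simp [src, tgt, Fin.ext_iff]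

lemma injective_ends : Function.Injective fun e : Edge i j m => s(src e, tgt e) := by
  rintro ⟨k, (_ | s) | ⟨e, _ | _⟩⟩ ⟨k', (_ | s') | ⟨e', _ | _⟩⟩ h <;>
    simp only [src, tgt, Sym2.eq_iff, Option.some.injEq, Prod.mk.injEq, Sum.inl.injEq,
      Sum.inr.injEq, reduceCtorEq, and_false, false_and, or_false, and_true,
      Fin.ext_iff, Fin.val_succ, Fin.val_castSucc, Fin.val_zero] at h ⊢
  all_goals grind

variable {N : Type u}

lemma injective_ends_equiv (ε : Vtx i j m ≃ N) :
    Function.Injective fun e : Edge i j m => s(ε (src e), ε (tgt e)) := by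
  intro e e' h
  refine injective_ends (Sym2.map.injective ε.injective ?_)
  simpa only [Sym2.map_mk, Prod.map_apply] using h

lemma edgeSet_eq_range (ε : Vtx i j m ≃ N) :
    (graphOf (fun e => ε (src e)) fun e => ε (tgt e)).edgeSet
      = Set.range fun e : Edge i j m => s(ε (src e), ε (tgt e)) :=
  graphOf_edgeSet fun e he => src_ne_tgt e (ε.injective he)

lemma ncard_edgeSet (ε : Vtx i j m ≃ N) :
    (graphOf (fun e => ε (src e)) fun e => ε (tgt e)).edgeSet.ncard
      = Fintype.card (Edge i j m) := by
  rw [edgeSet_eq_range, ← Set.image_univ, Set.ncard_image_of_injective _ (injective_ends_equiv ε),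
    Set.ncard_univ, Nat.card_eq_fintype_card]

/-! ### The graph of gadgets is not colourable -/

/-- If no edge at the centre had a conflict in some gadget, then all leaves of the gadget would take
their poor nodes, and so, one after the other, would the vertices of the path; the last one has
too many leaves for that. The conflicts in all gadgets of one kind are too many for the centre. -/
lemma not_isDefectiveDPColorable (ε : Vtx i j m ≃ N) :
    ¬ IsDefectiveDPColorable (graphOf (fun e => ε (src e)) fun e => ε (tgt e)) i j := by
  intro h
  obtain ⟨ψ, hψ⟩ := exists_card_le_of_isDefectiveDPColorable (sgn (i := i) (j := j) (m := m))
    (fun e he => src_ne_tgt e (ε.injective he)) (injective_ends_equiv ε) h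
  obtain ⟨φ, rfl⟩ : ∃ φ : Vtx i j m → Bool, ψ = fun v => φ (ε.symm v) :=
    ⟨fun v => ψ (ε v), by simp⟩
  replace hψ : ∀ (v : Vtx i j m) (ι : Type) [Fintype ι] (f : ι → Edge i j m), Function.Injective f →
      (∀ k, (src (f k) = v ∨ tgt (f k) = v) ∧ sgn (f k) = (φ (src (f k)) ^^ φ (tgt (f k)))) →
      Fintype.card ι ≤ bif φ v then j else i := by
    intro v ι _ f hf hfv
    have := hψ (ε v) ι f hf (by simpa using hfv)
    simpa using this
  -- the conflict of a gadget with the centre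
  have key : ∀ k : Kind i j, k.isRight = !(φ none) → ∃ e : Option (Fin m) ⊕ Leaf i m × Bool,
      tgt (k, e) = none ∧ sgn (k, e) = (φ (src (k, e)) ^^ φ none) := by
    intro k hk
    by_contra hcon
    push Not at hcon
    have hpoor : ∀ {α : Bool}, k.isRight ≠ (α ^^ φ none) → α = false := by
      intro α hα
      rw [hk] at hα
      revert hα
      cases α <;> simp
    have h0 : φ (some (k, .inl 0)) = false := hpoor (hcon (.inl none) rfl)
    have hleaf : ∀ e, φ (some (k, .inr e)) = false := fun e => hpoor (hcon (.inr (e, false)) rfl)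
    have hpath : ∀ t : Fin (m + 1), φ (some (k, .inl t)) = false := by
      intro t
      induction t using Fin.induction with
      | zero => exact h0
      | succ s ih =>
        by_contra hs
        rw [Bool.not_eq_false] at hs
        have := hψ (some (k, .inl s.castSucc)) (Option (Fin i)) (fun l => l.elim (k, .inl (some s))
          fun l => (k, .inr (.inl (s.castSucc, l), true))) (by
            rintro (_ | l) (_ | l') hl <;> simp at hl ⊢
            exact hl) (by
            rintro (_ | l)
            · simp [src, tgt, sgn, hs, ih]
            · simp [src, tgt, sgn, base, ih, hleaf])
        rw [ih] at this
        simp at this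
    have := hψ (some (k, .inl (Fin.last m))) (Option (Fin i)) (fun l => l.elim (k, .inr (.inr (), true))
      fun l => (k, .inr (.inl (Fin.last m, l), true))) (by
        rintro (_ | l) (_ | l') hl <;> simp at hl ⊢
        exact hl) (by
        rintro (_ | l)
        · simp [src, tgt, sgn, base, hpath, hleaf]
        · simp [src, tgt, sgn, base, hpath, hleaf])
    rw [hpath] at this
    simp at this
  rcases hc : φ none with _ | _
  · have h1 : ∀ k : Fin (i + 1), _ := fun k => key (.inr k) (by simp [hc])
    choose f hf hf2 using h1
    have := hψ none (Fin (i + 1)) (fun k => (.inr k, f k))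
      (fun k k' h => by simpa using congrArg Prod.fst h)
      fun k => ⟨Or.inr (hf k), by rw [hf2, hf]⟩
    rw [hc] at this
    simp at this
  · have h1 : ∀ k : Fin (j + 1), _ := fun k => key (.inl k) (by simp [hc])
    choose f hf hf2 using h1
    have := hψ none (Fin (j + 1)) (fun k => (.inl k, f k))
      (fun k k' h => by simpa using congrArg Prod.fst h)
      fun k => ⟨Or.inr (hf k), by rw [hf2, hf]⟩
    rw [hc] at this
    simp at this

/-! ### The graph of gadgets is sparse -/

lemma card_vtx : (Fintype.card (Vtx i j m) : ℤ)
    = 1 + (i + j + 2) * ((m + 1) * (i + 1) + 1) := by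
  simp only [Fintype.card_option, Fintype.card_prod, Fintype.card_sum, Fintype.card_fin,
    Fintype.card_unit]
  push_cast
  ring

lemma card_edge : (Fintype.card (Edge i j m) : ℤ)
    = (i + j + 2) * ((m + 1) * (2 * i + 1) + 2) := by
  simp only [Fintype.card_option, Fintype.card_prod, Fintype.card_sum, Fintype.card_fin,
    Fintype.card_unit, Fintype.card_bool]
  push_cast
  ring

/-- A part of a gadget, given by indicator functions: the vertices of the path, the leaves, the
centre, the edges of the path and the two edges at every leaf. Counted with weight `2 * i + 1` for a
vertex and `-(i + 1)` for an edge it amounts to at least `-1`, and to less than `0` only if it is the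
whole gadget together with the centre. -/
lemma weight_nonneg_or {y : Fin (m + 1) → ℤ} {l : Leaf i m → ℤ} {c s : ℤ} {p : Fin m → ℤ}
    {lc lp : Leaf i m → ℤ} (hy : ∀ t, y t ≤ 1) (hl0 : ∀ e, 0 ≤ l e) (hl : ∀ e, l e ≤ 1) (hc : c ≤ 1)
    (hs0 : s ≤ y 0) (hsc : s ≤ c) (hp1 : ∀ t, p t ≤ y t.succ) (hp2 : ∀ t, p t ≤ y t.castSucc)
    (hlc : ∀ e, lc e ≤ l e) (hlp : ∀ e, lp e ≤ l e) (hlp2 : ∀ e, lp e ≤ y (base e))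
    (hy0 : ∀ t, 0 ≤ y t) :
    0 ≤ (2 * i + 1) * (∑ t, y t + ∑ e, l e) - (i + 1) * (s + ∑ t, p t + (∑ e, lc e + ∑ e, lp e)) ∨
    ((2 * i + 1) * (∑ t, y t + ∑ e, l e) - (i + 1) * (s + ∑ t, p t + (∑ e, lc e + ∑ e, lp e)) = -1 ∧
      c = 1 ∧ (∀ t, y t = 1) ∧ (∀ e, l e = 1) ∧ s = 1 ∧ (∀ t, p t = 1) ∧ (∀ e, lc e = 1) ∧
      ∀ e, lp e = 1) := by
  -- every leaf is charged to its vertex of the path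
  have hbase : ∑ e : Leaf i m, y (base e) = i * ∑ t, y t + y (Fin.last m) := by
    rw [Fintype.sum_sum_type, Fintype.sum_prod_type, Finset.mul_sum]
    simp [base]
  have hleaf : ∀ e ∈ Finset.univ, 0 ≤ (2 * i + 1) * l e - (i + 1) * (lc e + lp e) + y (base e) := by
    intro e _
    have h1 := hlc e
    have h2 := hlp e
    have h3 := hlp2 e
    have h4 := hy0 (base e)
    have h5 : l e = 0 ∨ l e = 1 := by have := hl0 e; have := hl e; omega
    rcases h5 with h5 | h5
    · rw [h5] at h1 h2 ⊢
      nlinarith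
    · rw [h5] at h1 h2 ⊢
      have h6 : lp e ≤ 0 ∨ lp e = 1 := by omega
      rcases h6 with h6 | h6
      · nlinarith
      · rw [h6] at h3 ⊢
        nlinarith
  have hpath : ∀ t ∈ Finset.univ, 0 ≤ y (Fin.succ t) - p t := fun t _ => by linarith [hp1 t]
  have hsplit : (2 * i + 1) * (∑ t, y t + ∑ e, l e)
      - (i + 1) * (s + ∑ t, p t + (∑ e, lc e + ∑ e, lp e))
      = (i + 1) * ((y 0 - s) + ∑ t, (y (Fin.succ t) - p t)) - y (Fin.last m)
        + ∑ e, ((2 * i + 1) * l e - (i + 1) * (lc e + lp e) + y (base e)) := by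
    rw [Finset.sum_add_distrib, hbase, Finset.sum_sub_distrib, Finset.sum_sub_distrib,
      ← Finset.mul_sum, ← Finset.mul_sum, Finset.sum_add_distrib, Fin.sum_univ_succ]
    ring
  rw [hsplit]
  have hL := Finset.sum_nonneg hleaf
  have hP := Finset.sum_nonneg hpath
  have hlast := hy (Fin.last m)
  set P := ∑ t, (y (Fin.succ t) - p t) with hPdef
  set L := ∑ e, ((2 * (i : ℤ) + 1) * l e - (i + 1) * (lc e + lp e) + y (base e)) with hLdef
  by_cases hneg : 0 ≤ (i + 1) * ((y 0 - s) + P) - y (Fin.last m) + L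
  · exact Or.inl hneg
  right
  push Not at hneg
  have h1 : y 0 - s + P = 0 := by
    by_contra hne
    have : 1 ≤ y 0 - s + P := by omega
    nlinarith
  rw [h1] at hneg ⊢
  have h2 : y (Fin.last m) = 1 := by linarith
  have h3 : L = 0 := by linarith
  have h4 : P = 0 := by linarith
  have hp : ∀ t, y (Fin.succ t) = p t := fun t => by
    have := (Finset.sum_eq_zero_iff_of_nonneg hpath).1 h4 t (Finset.mem_univ t)
    linarith
  have hy1 : ∀ t, y t = 1 := by
    intro t
    induction t using Fin.reverseInduction with
    | last => exact h2
    | cast t ih =>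
      have := hp2 t
      have := hp t
      have := hy t.castSucc
      linarith
  have hl1 : ∀ e, l e = 1 ∧ lc e = 1 ∧ lp e = 1 := by
    intro e
    have h5 := (Finset.sum_eq_zero_iff_of_nonneg hleaf).1 h3 e (Finset.mem_univ e)
    rw [hy1] at h5
    have h6 := hlc e
    have h7 := hlp e
    have h8 : l e = 0 ∨ l e = 1 := by have := hl0 e; have := hl e; omega
    rcases h8 with h8 | h8
    · rw [h8] at h5 h6 h7
      nlinarith
    · rw [h8] at h5 h6 h7
      have h9 : lc e + lp e = 2 := by nlinarith
      exact ⟨h8, by omega, by omega⟩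
  have hs1 : s = 1 := by have := hy1 0; linarith
  refine ⟨by rw [h2, h3]; ring, by linarith, hy1, fun e => (hl1 e).1, hs1,
    fun t => by rw [← hp, hy1], fun e => (hl1 e).2.1, fun e => (hl1 e).2.2⟩

/-- A proper subgraph misses part of some gadget, or the centre. -/
lemma mul_ncard_edgeSet_le (ε : Vtx i j m ≃ N)
    (H : (graphOf (fun e => ε (src e)) fun e => ε (tgt e)).Subgraph) (hH : H ≠ ⊤)
    (hij : i ≤ j) :
    ((i : ℤ) + 1) * H.edgeSet.ncard ≤ (2 * i + 1) * H.verts.ncard + j - i := by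
  classical
  set x : Vtx i j m → ℤ := fun v => if ε v ∈ H.verts then 1 else 0 with hx
  set z : Edge i j m → ℤ := fun e => if H.Adj (ε (src e)) (ε (tgt e)) then 1 else 0 with hz
  have hx0 : ∀ v, 0 ≤ x v := fun v => by simp only [hx]; split_ifs <;> norm_num
  have hx1 : ∀ v, x v ≤ 1 := fun v => by simp only [hx]; split_ifs <;> norm_num
  have hzs : ∀ e, z e ≤ x (src e) := by
    intro e
    by_cases h : H.Adj (ε (src e)) (ε (tgt e))
    · have h1 : ε (src e) ∈ H.verts := H.edge_vert h
      simp [hx, hz, h1, h]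
    · simpa [hz, h] using hx0 (src e)
  have hzt : ∀ e, z e ≤ x (tgt e) := by
    intro e
    by_cases h : H.Adj (ε (src e)) (ε (tgt e))
    · have h1 : ε (tgt e) ∈ H.verts := H.edge_vert h.symm
      simp [hx, hz, h1, h]
    · simpa [hz, h] using hx0 (tgt e)
  have hV : (H.verts.ncard : ℤ) = ∑ v, x v := by
    have h1 : H.verts = ε '' ((Finset.univ.filter fun v => ε v ∈ H.verts : Finset _) : Set _) := by
      ext v
      simp only [Finset.coe_filter, Finset.mem_univ, true_and, Set.mem_image, Set.mem_ofPred_eq]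
      exact ⟨fun h => ⟨ε.symm v, by simpa using h, by simp⟩, by rintro ⟨w, hw, rfl⟩; exact hw⟩
    rw [h1, Set.ncard_image_of_injective _ ε.injective, Set.ncard_coe_finset, Finset.card_filter]
    push_cast
    rfl
  have hE : (H.edgeSet.ncard : ℤ) = ∑ e, z e := by
    have h1 : H.edgeSet = (fun e : Edge i j m => s(ε (src e), ε (tgt e))) ''
        ((Finset.univ.filter fun e => H.Adj (ε (src e)) (ε (tgt e)) : Finset _) : Set _) := by
      ext p
      simp only [Finset.coe_filter, Finset.mem_univ, true_and, Set.mem_image, Set.mem_ofPred_eq]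
      refine ⟨fun h => ?_, by rintro ⟨e, he, rfl⟩; exact he⟩
      have h2 := H.edgeSet_subset h
      rw [edgeSet_eq_range] at h2
      obtain ⟨e, rfl⟩ := h2
      exact ⟨e, h, rfl⟩
    rw [h1, Set.ncard_image_of_injective _ (injective_ends_equiv ε), Set.ncard_coe_finset,
      Finset.card_filter]
    push_cast
    rfl
  set D : Kind i j → ℤ := fun k => (2 * i + 1) * (∑ t, x (some (k, .inl t))
      + ∑ e, x (some (k, .inr e))) - (i + 1) * (z (k, .inl none) + ∑ s, z (k, .inl (some s))
      + (∑ e, z (k, .inr (e, false)) + ∑ e, z (k, .inr (e, true)))) with hD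
  have hdecomp : (2 * (i : ℤ) + 1) * ∑ v, x v - (i + 1) * ∑ e, z e
      = (2 * i + 1) * x none + ∑ k, D k := by
    simp only [hD]
    rw [Finset.sum_sub_distrib, ← Finset.mul_sum, ← Finset.mul_sum, Fintype.sum_option,
      Fintype.sum_prod_type, Fintype.sum_prod_type]
    simp only [Fintype.sum_sum_type (α₁ := Fin (m + 1)),
      Fintype.sum_sum_type (α₁ := Option (Fin m)),
      Fintype.sum_option, Fintype.sum_prod_type (α₁ := Leaf i m),
      Fintype.sum_bool, Finset.sum_add_distrib]
    ring
  have hDk : ∀ k, _ := fun k => weight_nonneg_or (i := i) (y := fun t => x (some (k, .inl t)))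
    (l := fun e => x (some (k, .inr e))) (c := x none) (s := z (k, .inl none))
    (p := fun s => z (k, .inl (some s))) (lc := fun e => z (k, .inr (e, false)))
    (lp := fun e => z (k, .inr (e, true))) (fun _ => hx1 _) (fun _ => hx0 _) (fun _ => hx1 _)
    (hx1 _) (hzs (k, .inl none)) (hzt (k, .inl none)) (fun s => hzs (k, .inl (some s)))
    (fun s => hzt (k, .inl (some s))) (fun e => hzs (k, .inr (e, false)))
    (fun e => hzs (k, .inr (e, true))) (fun e => hzt (k, .inr (e, true))) fun _ => hx0 _
  have hgoal : (i : ℤ) - j ≤ (2 * i + 1) * x none + ∑ k, D k := by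
    by_cases hall : ∀ k, D k ≤ -1
    · exfalso
      have hfull : ∀ k, _ := fun k => (hDk k).resolve_left fun h => by
        have := hall k
        simp only [hD] at this
        linarith
      have hxall : ∀ v, x v = 1 := by
        rintro (_ | ⟨k, t | e⟩)
        · exact (hfull (.inl 0)).2.1
        · exact (hfull k).2.2.1 t
        · exact (hfull k).2.2.2.1 e
      have hzall : ∀ e, z e = 1 := by
        rintro ⟨k, (_ | s) | ⟨e, _ | _⟩⟩
        · exact (hfull k).2.2.2.2.1
        · exact (hfull k).2.2.2.2.2.1 s
        · exact (hfull k).2.2.2.2.2.2.1 e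
        · exact (hfull k).2.2.2.2.2.2.2 e
      apply hH
      refine SimpleGraph.Subgraph.ext ?_ ?_
      · ext v
        have h1 := hxall (ε.symm v)
        simp only [hx, ε.apply_symm_apply] at h1
        by_contra hcon
        simp only [SimpleGraph.Subgraph.verts_top, Set.mem_univ, iff_true] at hcon
        simp [hcon] at h1
      · ext u v
        refine ⟨fun h => H.adj_sub h, fun h => ?_⟩
        have h2 : s(u, v) ∈ (graphOf (fun e : Edge i j m => ε (src e)) fun e => ε (tgt e)).edgeSet :=
          h
        rw [edgeSet_eq_range] at h2
        obtain ⟨e, he⟩ := h2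
        have h1 := hzall e
        simp only [hz] at h1
        have h3 : H.Adj (ε (src e)) (ε (tgt e)) := by
          by_contra hcon
          simp [hcon] at h1
        dsimp only at he
        rwa [← SimpleGraph.Subgraph.mem_edgeSet, he] at h3
    · push Not at hall
      obtain ⟨k₀, hk₀⟩ := hall
      have hge : ∀ k, -1 ≤ D k := fun k => by
        rcases hDk k with h | h
        · simp only [hD]; linarith
        · simp only [hD]; linarith [h.1]
      have hc : x none = 0 ∨ x none = 1 := by have := hx0 none; have := hx1 none; omega
      rcases hc with hc | hc
      · have : 0 ≤ ∑ k, D k := Finset.sum_nonneg fun k _ => by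
          rcases hDk k with h | h
          · exact h
          · have := h.2.1; omega
        rw [hc]
        have : (i : ℤ) ≤ j := by exact_mod_cast hij
        linarith
      · have h1 : ∑ k : Kind i j, ((-1 : ℤ) + if k = k₀ then 1 else 0) ≤ ∑ k, D k :=
          Finset.sum_le_sum fun k _ => by
            split_ifs with h
            · subst h; linarith
            · linarith [hge k]
        rw [Finset.sum_add_distrib, Finset.sum_ite_eq', if_pos (Finset.mem_univ _),
          Finset.sum_const, Finset.card_univ, Fintype.card_sum, Fintype.card_fin,
          Fintype.card_fin] at h1
        rw [hc]
        simp only [nsmul_eq_mul] at h1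
        push_cast at h1
        linarith
  rw [hV, hE]
  linarith

end Gadget

end DefectiveDP

theorem mainTheorem3 (i j : ℕ) (hi : i = 1 ∨ i = 2) (hj : 2 * i ≤ j) :
    (∀ (V : Type u) [Finite V] (G : SimpleGraph V),
      (∀ H : G.Subgraph,
        (H.edgeSet.ncard : ℚ) ≤ ((2 * i + 1) * H.verts.ncard + j - i) / (i + 1)) →
      IsDefectiveDPColorable G i j) ∧
    (∀ N : ℕ, ∃ n : ℕ, N ≤ n ∧ ∃ G : SimpleGraph (Fin n),
      ¬ IsDefectiveDPColorable G i j ∧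
      (G.edgeSet.ncard : ℚ) = ((2 * i + 1) * n + j - i + 1) / (i + 1) ∧
      ∀ H : G.Subgraph, H ≠ ⊤ →
        (H.edgeSet.ncard : ℚ) ≤ ((2 * i + 1) * H.verts.ncard + j - i) / (i + 1)) := by
  refine ⟨fun V _ G hG => DefectiveDP.isDefectiveDPColorable_of_sparse hi hj hG, fun N => ?_⟩
  have hv := DefectiveDP.Gadget.card_vtx (i := i) (j := j) (m := N)
  have he := DefectiveDP.Gadget.card_edge (i := i) (j := j) (m := N)
  refine ⟨Fintype.card (DefectiveDP.Gadget.Vtx i j N), ?_, _,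
    DefectiveDP.Gadget.not_isDefectiveDPColorable (Fintype.equivFin _), ?_, fun H hH => ?_⟩
  · have : (N : ℤ) ≤ 1 + (i + j + 2) * ((N + 1) * (i + 1) + 1) := by
      have h1 : (0 : ℤ) ≤ i := by positivity
      have h2 : (0 : ℤ) ≤ j := by positivity
      have h3 : (0 : ℤ) ≤ N := by positivity
      have h4 : (N : ℤ) + 1 ≤ (N + 1) * (i + 1) := by nlinarith
      nlinarith
    rw [← hv] at this
    exact_mod_cast this
  · rw [DefectiveDP.Gadget.ncard_edgeSet, eq_div_iff (by positivity)]
    have hv' : (Fintype.card (DefectiveDP.Gadget.Vtx i j N) : ℚ)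
        = 1 + (i + j + 2) * ((N + 1) * (i + 1) + 1) := by exact_mod_cast hv
    have he' : (Fintype.card (DefectiveDP.Gadget.Edge i j N) : ℚ)
        = (i + j + 2) * ((N + 1) * (2 * i + 1) + 2) := by exact_mod_cast he
    rw [hv', he']
    ring
  · rw [le_div_iff₀ (by positivity)]
    have := DefectiveDP.Gadget.mul_ncard_edgeSet_le _ H hH (by omega)
    have h2 : ((i : ℚ) + 1) * H.edgeSet.ncard ≤ (2 * i + 1) * H.verts.ncard + j - i := by
      exact_mod_cast this
    linarith
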